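/- **Theorem 3 (Scaling exponent – MAP decoding with list).** Let $W$ be a binary-input memoryless output-symmetric channel (BMSC), with discrete or general output alphabet, Shannon capacity $C\in(0,1)$ (in bits) and Bhattacharyya parameter $Z=\int\sqrt{W(y|0)W(y|1)}\,dy\in(0,1)$. Consider a set of binary linear codes parameterized by their block length $N$ (ranging over an infinite set of integers) and rate $R$; the code for $(N,R)$, $0\le R\le 1$, has dimension $NR$, rounded up or down to an integer if necessary. For an integer $L\ge 1$ let $P_e^{\rm MAP}(N,R,W,L)$ be the block error probability of MAP decoding with list size $L$ when a uniformly distributed codeword is transmitted over $W$: an error is declared if and only if at least $L$ codewords other than the transmitted one have likelihood at least that of the transmitted one. Suppose that a scaling law holds for the MAP decoder without list, i.e. there are $\mu\in(0,\infty)$ (the scaling exponent) and $f:\mathbb R\to[0,1]$ (the mother curve) with $$\lim_{N\to\infty:\ N^{1/\mu}(C-R)=z}P_e^{\rm MAP}(N,R,W,1)=f(z)\qquad\text{for all } z\in\mathbb R .$$ Let $z\in\mathbb R$, and suppose that one of the following holds: (a) the codes are the polar codes for $W$: $N=2^n$, and the code for $(N,R)$ is generated by the rows of the Kronecker power $\begin{bmatrix}1&0\\1&1\end{bmatrix}^{\otimes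 n}$ whose synthetic channels $W_N^{(i)}$ have the smallest Bhattacharyya parameters (ties being broken arbitrarily); (b) the codes are arbitrary linear codes whose minimum distance $d_{\min}(N,R)$ tends to infinity as $N\to\infty$ with $N^{1/\mu}(C-R)=z$. Then, for every integer $L\ge 1$, $$\limsup_{N\to\infty:\ N^{1/\mu}(C-R)=z}P_e^{\rm MAP}(N,R,W,L)\le f(z),$$ $$\liminf_{N\to\infty:\ N^{1/\mu}(C-R)=z}P_e^{\rm MAP}(N,R,W,L)\ge\Bigl(\frac{3}{16}\Bigr)^{2^{L-1}-1}f(z)^{2^{L-1}} .$$ -/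

import Mathlib

open MeasureTheory Filter
open scoped ENNReal NNReal Topology

universe u

noncomputable section

/-- A memoryless channel with input alphabet `{0, 1}`. The output alphabet is an arbitrary measurable
space with a σ-finite reference measure (counting measure for a discrete channel, Lebesgue measure
for the additive Gaussian channel, ...); `density x y` is the transition density `W(y | x)`. -/
structure BinaryChannel where
  Out : Type u
  [measurableSpace : MeasurableSpace Out]
  ref : Measure Out
  [sigmaFinite : SigmaFinite ref]
  density : ZMod 2 → Out → ℝ≥0
  measurable_density : ∀ x, Measurable (density x)
  lintegral_density : ∀ x, ∫⁻ y, (density x y : ℝ≥0∞) ∂ref = 1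

attribute [instance] BinaryChannel.measurableSpace BinaryChannel.sigmaFinite

namespace BinaryChannel

/-- Output symmetry: some measure-preserving involution of the output alphabet exchanges the two
inputs, `W(y | 1) = W(π y | 0)`. -/
def IsSymmetric (W : BinaryChannel.{u}) : Prop :=
  ∃ π : W.Out → W.Out, MeasurePreserving π W.ref W.ref ∧ Function.Involutive π ∧
    ∀ y, W.density 1 y = W.density 0 (π y)

/-- The law of the output when `x` is transmitted. -/
def law (W : BinaryChannel.{u}) (x : ZMod 2) : Measure W.Out :=
  W.ref.withDensity fun y => (W.density x y : ℝ≥0∞)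

/-- The Bhattacharyya parameter `Z(W) = ∫ √(W(y|0) W(y|1)) dy`. -/
def bhattacharyya (W : BinaryChannel.{u}) : ℝ :=
  ∫ y, √((W.density 0 y : ℝ) * (W.density 1 y : ℝ)) ∂W.ref

/-- The mutual information (in bits) between input and output when the input equals `1` with
probability `p` and `0` with probability `1 - p`. -/
def mutualInfo (W : BinaryChannel.{u}) (p : ℝ) : ℝ :=
  let q : W.Out → ℝ := fun y => (1 - p) * (W.density 0 y : ℝ) + p * (W.density 1 y : ℝ)
  (1 - p) * ∫ y, (W.density 0 y : ℝ) * Real.logb 2 ((W.density 0 y : ℝ) / q y) ∂W.ref +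
    p * ∫ y, (W.density 1 y : ℝ) * Real.logb 2 ((W.density 1 y : ℝ) / q y) ∂W.ref

/-- The Shannon capacity (in bits per channel use). -/
def capacity (W : BinaryChannel.{u}) : ℝ :=
  sSup (W.mutualInfo '' Set.Icc 0 1)

/-- The likelihood `p(y | x) = ∏ᵢ W(yᵢ | xᵢ)`. -/
def likelihood (W : BinaryChannel.{u}) {N : ℕ} (y : Fin N → W.Out) (x : Fin N → ZMod 2) : ℝ≥0 :=
  ∏ i, W.density (x i) (y i)

open Classical in
/-- Block error probability under MAP decoding with list size `L` when a uniformly distributed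
codeword of the code `D` is transmitted over `W`: an error occurs when at least `L` codewords other
than the transmitted one are at least as likely as the transmitted one. -/
def mapListError (W : BinaryChannel.{u}) {N : ℕ} (D : Submodule (ZMod 2) (Fin N → ZMod 2))
    (L : ℕ) : ℝ :=
  (∑ x ∈ Finset.univ.filter (fun x : Fin N → ZMod 2 => x ∈ D),
    (Measure.pi fun i => W.law (x i)).real
      {y | L ≤ Set.ncard {x' : Fin N → ZMod 2 |
        x' ∈ D ∧ x' ≠ x ∧ W.likelihood y x ≤ W.likelihood y x'}}) / (Nat.card D : ℝ)

/-- The polar transform `W⁻(y₁, y₂ | u₁) = ½ ∑_{u₂} W(y₁ | u₁ + u₂) W(y₂ | u₂)`. -/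
def minus (W : BinaryChannel.{u}) : BinaryChannel.{u} where
  Out := W.Out × W.Out
  ref := W.ref.prod W.ref
  density x y := 2⁻¹ * ∑ v : ZMod 2, W.density (x + v) y.1 * W.density v y.2
  measurable_density x := by
    have h := W.measurable_density
    fun_prop
  lintegral_density x := by
    have h := W.measurable_density
    have key : ∀ v : ZMod 2, ∫⁻ y : W.Out × W.Out,
        ((W.density (x + v) y.1 : ℝ≥0∞) * (W.density v y.2 : ℝ≥0∞)) ∂(W.ref.prod W.ref) = 1 := by
      intro v
      rw [lintegral_prod_mul (f := fun y => (W.density (x + v) y : ℝ≥0∞))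
        (g := fun y => (W.density v y : ℝ≥0∞)) (by fun_prop) (by fun_prop),
        W.lintegral_density, W.lintegral_density, one_mul]
    push_cast
    rw [lintegral_const_mul _ (by fun_prop), lintegral_finsetSum _ (by fun_prop)]
    simp only [key]
    simp only [Finset.sum_const, Finset.card_univ, ZMod.card, nsmul_eq_mul, mul_one]
    exact ENNReal.inv_mul_cancel (by norm_num) (by norm_num)

/-- The polar transform `W⁺(y₁, y₂, u₁ | u₂) = ½ W(y₁ | u₁ + u₂) W(y₂ | u₂)`; the third component
of the output is the bit `u₁`. -/
def plus (W : BinaryChannel.{u}) : BinaryChannel.{u} where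
  Out := (W.Out × W.Out) × Fin 2
  ref := (W.ref.prod W.ref).prod Measure.count
  density x y := 2⁻¹ * (W.density (((y.2 : ℕ) : ZMod 2) + x) y.1.1 * W.density x y.1.2)
  measurable_density x := by
    have h := W.measurable_density
    refine measurable_from_prod_countable_left fun v => ?_
    dsimp only
    fun_prop
  lintegral_density x := by
    have h := W.measurable_density
    have key : ∀ v : Fin 2, ∫⁻ y : W.Out × W.Out,
        ((W.density (((v : ℕ) : ZMod 2) + x) y.1 : ℝ≥0∞) * (W.density x y.2 : ℝ≥0∞))
          ∂(W.ref.prod W.ref) = 1 := by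
      intro v
      rw [lintegral_prod_mul (f := fun y => (W.density (((v : ℕ) : ZMod 2) + x) y : ℝ≥0∞))
        (g := fun y => (W.density x y : ℝ≥0∞)) (by fun_prop) (by fun_prop),
        W.lintegral_density, W.lintegral_density, one_mul]
    have hm : Measurable fun y : (W.Out × W.Out) × Fin 2 =>
        (((2⁻¹ * (W.density (((y.2 : ℕ) : ZMod 2) + x) y.1.1 * W.density x y.1.2) : ℝ≥0)) : ℝ≥0∞) := by
      refine measurable_from_prod_countable_left fun v => ?_
      dsimp only
      fun_prop
    rw [lintegral_prod_symm _ hm.aemeasurable, lintegral_count, tsum_fintype]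
    simp only [ENNReal.coe_mul, ENNReal.coe_inv two_ne_zero, ENNReal.coe_ofNat]
    have : ∀ v : Fin 2, ∫⁻ y : W.Out × W.Out, (2⁻¹ : ℝ≥0∞) *
        ((W.density (((v : ℕ) : ZMod 2) + x) y.1 : ℝ≥0∞) * (W.density x y.2 : ℝ≥0∞))
          ∂(W.ref.prod W.ref) = (2⁻¹ : ℝ≥0∞) := by
      intro v
      rw [lintegral_const_mul _ (by fun_prop), key, mul_one]
    simp only [this]
    simp only [Finset.sum_const, Finset.card_univ, Fintype.card_fin, nsmul_eq_mul]
    exact ENNReal.mul_inv_cancel (by norm_num) (by norm_num)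

/-- The synthetic channels at block length `2 ^ n`, with indices `i = 0, ..., 2 ^ n - 1`: channel
`2 i` at level `n + 1` is the minus transform and channel `2 i + 1` the plus transform of channel
`i` at level `n`. -/
def synthetic (W : BinaryChannel.{u}) : ℕ → ℕ → BinaryChannel.{u}
  | 0, _ => W
  | n + 1, i => if i % 2 = 1 then (W.synthetic n (i / 2)).plus else (W.synthetic n (i / 2)).minus

end BinaryChannel

/-- The `n`-th Kronecker power of `[1 0; 1 1]`, rows and columns being indexed by the integers
`0, ..., 2 ^ n - 1` through their binary expansions. -/
def polarMatrix (n : ℕ) : Matrix (Fin (2 ^ n)) (Fin (2 ^ n)) (ZMod 2) :=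
  Matrix.of fun i j => ∏ t : Fin n, (!![1, 0; 1, 1] : Matrix (Fin 2) (Fin 2) (ZMod 2))
    (finFunctionFinEquiv.symm i t) (finFunctionFinEquiv.symm j t)

/-- A set of binary linear codes, parameterized by the block length `N` (which ranges over an
infinite set of integers) and the rate `R`. The dimension is `N R` if this is an integer, and `N R`
rounded up or down otherwise. -/
structure LinearCodeFamily where
  lengths : Set ℕ
  infinite_lengths : lengths.Infinite
  code : (N : ℕ) → ℝ → Submodule (ZMod 2) (Fin N → ZMod 2)
  dim_code : ∀ N ∈ lengths, ∀ R ∈ Set.Icc (0 : ℝ) 1,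
    |(Module.finrank (ZMod 2) (code N R) : ℝ) - N * R| < 1

/-- The minimum distance of a linear code: the least weight of a nonzero codeword. -/
def minDistance {N : ℕ} (D : Submodule (ZMod 2) (Fin N → ZMod 2)) : ℕ :=
  sInf {d | ∃ x ∈ D, x ≠ 0 ∧ hammingNorm x = d}

/-- The family consists of the polar codes for `W`: the block lengths are the powers of two, and
the code of length `2 ^ n` is generated by the rows of the Kronecker power whose synthetic channels
have the smallest Bhattacharyya parameters (ties being broken arbitrarily). -/
def IsPolarFamily (W : BinaryChannel.{u}) (F : LinearCodeFamily) : Prop :=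
  F.lengths = Set.range (fun n : ℕ => 2 ^ n) ∧
  ∀ n : ℕ, ∀ R ∈ Set.Icc (0 : ℝ) 1, ∃ A : Set (Fin (2 ^ n)),
    (∀ i ∈ A, ∀ j ∉ A,
      (W.synthetic n i).bhattacharyya ≤ (W.synthetic n j).bhattacharyya) ∧
    F.code (2 ^ n) R = Submodule.span (ZMod 2) ((fun i => (polarMatrix n).row i) '' A)

/-- `N → ∞` along the pairs `(N, R)` with admissible block length `N` and `N ^ (1/μ) (C - R) = z`. -/
def scalingFilter (lengths : Set ℕ) (C μ z : ℝ) : Filter (ℕ × ℝ) :=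
  comap Prod.fst atTop ⊓
    𝓟 {x | x.1 ∈ lengths ∧ (x.1 : ℝ) ^ (1 / μ) * (C - x.2) = z}

/-- The error probability `Pe N R` obeys a scaling law around the capacity `C` with scaling exponent
`μ` and mother curve `f`. -/
def ScalingLaw (lengths : Set ℕ) (C : ℝ) (Pe : ℕ → ℝ → ℝ) (μ : ℝ) (f : ℝ → ℝ) : Prop :=
  0 < μ ∧ (∀ z, f z ∈ Set.Icc (0 : ℝ) 1) ∧
  ∀ z, Tendsto (fun x : ℕ × ℝ => Pe x.1 x.2) (scalingFilter lengths C μ z) (𝓝 (f z))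

end

/-! ### Correlation inequality for product measures -/

/-! The upper bound holds because the error probability decreases in the list size. The lower bound
rests on one inequality for a fixed code: if p is the error probability with list size L, then list
size L + 1 gives at least p²/4 - Z^d, where d bounds the weights of nonzero codewords from below.
Once d tends to infinity, iterating L - 1 times yields the constant (1/4)^(2^(L-1) - 1), which
dominates the one required.

To prove the inequality, fix the transmitted word x and pass to the likelihood ratios of the wrong
symbol to the sent one. They are independent, and for every competitor the event that it is at least
as likely as x is increasing in them. The event that at least L competitors win is the union, over
L-element sets T, of the events that all of T win. Each of these has probability at most Z^d, so the
sets T can be split into two classes whose unions A and B both have probability about p/2. On A ∩ B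
two different L-sets win, hence at least L + 1 words; Harris' inequality gives P(A ∩ B) ≥ P(A) P(B).
Convexity of the square transfers the bound to the average over codewords
(`sq_mapListError_div_four_sub_le`).

For polar codes it remains to see that the minimum distance diverges. A nonzero codeword has weight
at least 2^w, with w the number of binary ones of some selected index
(`exists_two_pow_binaryWeight_le_hammingNorm`). An index with few ones is less reliable than every
index with more than K ones (`exists_bhattacharyya_synthetic_lt`, proved by tracking total
variation). Selecting the former would force selecting all the latter, that is almost all indices,
contradicting a rate bounded away from 1. -/

theorem ENNReal.mul_add_mul_le_mul_add_mul_of_le {a b c d : ℝ≥0∞} (hab : a ≤ b) (hcd : c ≤ d) :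
    a * d + b * c ≤ a * c + b * d := by
  obtain ⟨s, rfl⟩ := exists_add_of_le hab
  obtain ⟨t, rfl⟩ := exists_add_of_le hcd
  calc a * (c + t) + (a + s) * c ≤ a * (c + t) + (a + s) * c + s * t := le_self_add
    _ = a * c + (a + s) * (c + t) := by ring

/-- Chebyshev's association inequality. -/
theorem lintegral_mul_lintegral_le_of_monotone {α : Type*} [LinearOrder α] [MeasurableSpace α]
    (ν : Measure α) [IsProbabilityMeasure ν] {F G : α → ℝ≥0∞} (hF : Monotone F) (hG : Monotone G)
    (hFm : Measurable F) (hGm : Measurable G) :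
    (∫⁻ a, F a ∂ν) * (∫⁻ a, G a ∂ν) ≤ ∫⁻ a, F a * G a ∂ν := by
  have key : ∀ a b, F a * G b + F b * G a ≤ F a * G a + F b * G b := by
    intro a b
    rcases le_total a b with h | h
    · exact ENNReal.mul_add_mul_le_mul_add_mul_of_le (hF h) (hG h)
    · have := ENNReal.mul_add_mul_le_mul_add_mul_of_le (hF h) (hG h)
      rwa [add_comm, add_comm (F a * G a)]
  -- Integrating `key` over an independent pair (a, b) gives twice the desired inequality.
  have h1 : ∫⁻ a, ∫⁻ b, (F a * G b + F b * G a) ∂ν ∂ν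
      ≤ ∫⁻ a, ∫⁻ b, (F a * G a + F b * G b) ∂ν ∂ν :=
    lintegral_mono fun a => lintegral_mono fun b => key a b
  have h2 : ∀ a, ∫⁻ b, (F a * G b + F b * G a) ∂ν
      = F a * ∫⁻ b, G b ∂ν + (∫⁻ b, F b ∂ν) * G a := by
    intro a
    rw [lintegral_add_left (by fun_prop), lintegral_const_mul _ hGm, lintegral_mul_const _ hFm]
  have h3 : ∀ a, ∫⁻ b, (F a * G a + F b * G b) ∂ν = F a * G a + ∫⁻ b, F b * G b ∂ν := by
    intro a
    rw [lintegral_add_left (by fun_prop)]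
    simp
  simp only [h2, h3] at h1
  rw [lintegral_add_left (by fun_prop), lintegral_add_left (by fun_prop),
    lintegral_mul_const _ hFm, lintegral_const_mul _ hGm, lintegral_const, measure_univ, mul_one,
    ← two_mul, ← two_mul] at h1
  exact (ENNReal.mul_le_mul_iff_right (by norm_num) (by norm_num)).1 h1

theorem lintegral_pi_succ {α : Type*} [MeasurableSpace α] {n : ℕ}
    (ν : Fin (n + 1) → Measure α) [∀ i, IsProbabilityMeasure (ν i)]
    {F : (Fin (n + 1) → α) → ℝ≥0∞} (hF : Measurable F) :
    ∫⁻ u, F u ∂(Measure.pi ν) =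
      ∫⁻ a, ∫⁻ v, F (Fin.cons a v) ∂(Measure.pi fun j : Fin n => ν j.succ) ∂(ν 0) := by
  have h := (measurePreserving_piFinSuccAbove ν 0).symm
  rw [← h.lintegral_comp hF, lintegral_prod _ (by fun_prop)]
  simp only [Fin.succAbove_zero]
  exact lintegral_congr fun a => lintegral_congr fun v => congrArg F (Fin.insertNth_zero' a v)

theorem measurable_finCons {α : Type*} [MeasurableSpace α] {n : ℕ} :
    Measurable fun p : α × (Fin n → α) => (Fin.cons p.1 p.2 : Fin (n + 1) → α) := by
  refine measurable_pi_lambda _ fun i => ?_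
  refine Fin.cases ?_ (fun j => ?_) i
  · simpa using measurable_fst
  · simp only [Fin.cons_succ]
    fun_prop

/-- Harris' inequality. -/
theorem lintegral_mul_lintegral_le_of_monotone_pi {α : Type*} [LinearOrder α] [MeasurableSpace α]
    {n : ℕ} (ν : Fin n → Measure α) [∀ i, IsProbabilityMeasure (ν i)]
    {F G : (Fin n → α) → ℝ≥0∞} (hF : Monotone F) (hG : Monotone G)
    (hFm : Measurable F) (hGm : Measurable G) :
    (∫⁻ u, F u ∂(Measure.pi ν)) * (∫⁻ u, G u ∂(Measure.pi ν)) ≤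
      ∫⁻ u, F u * G u ∂(Measure.pi ν) := by
  induction n with
  | zero =>
    have h : ∀ H : (Fin 0 → α) → ℝ≥0∞, H = fun _ => H Fin.elim0 := fun H =>
      funext fun u => congrArg H (Subsingleton.elim _ _)
    rw [h F, h G]
    simp
  | succ n ih =>
    have hFc : Measurable fun p : α × (Fin n → α) => F (Fin.cons p.1 p.2) :=
      hFm.comp measurable_finCons
    have hGc : Measurable fun p : α × (Fin n → α) => G (Fin.cons p.1 p.2) :=
      hGm.comp measurable_finCons
    rw [lintegral_pi_succ ν hFm, lintegral_pi_succ ν hGm, lintegral_pi_succ ν (F := fun u => F u * G u) (hFm.mul hGm)]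
    -- With the last n coordinates integrated out, F and G are still monotone in the first one, so
    -- Chebyshev applies there; for each fixed first coordinate the induction hypothesis applies to
    -- the sections.
    refine (lintegral_mul_lintegral_le_of_monotone (ν 0) ?_ ?_ hFc.lintegral_prod_right'
      hGc.lintegral_prod_right').trans (lintegral_mono fun a => ?_)
    · exact fun a b hab => lintegral_mono fun v => hF (Fin.cons_le_cons.2 ⟨hab, le_rfl⟩)
    · exact fun a b hab => lintegral_mono fun v => hG (Fin.cons_le_cons.2 ⟨hab, le_rfl⟩)
    · exact ih (fun j => ν j.succ) (fun v w h => hF (Fin.cons_le_cons.2 ⟨le_rfl, h⟩))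
        (fun v w h => hG (Fin.cons_le_cons.2 ⟨le_rfl, h⟩))
        (hFc.comp measurable_prodMk_left) (hGc.comp measurable_prodMk_left)

theorem lintegral_pi_prod {α : Type*} [MeasurableSpace α] {n : ℕ}
    (ν : Fin n → Measure α) [∀ i, IsProbabilityMeasure (ν i)]
    {g : Fin n → α → ℝ≥0∞} (hg : ∀ i, Measurable (g i)) :
    ∫⁻ u, ∏ i, g i (u i) ∂(Measure.pi ν) = ∏ i, ∫⁻ a, g i a ∂(ν i) := by
  induction n with
  | zero => simp
  | succ n ih =>
    have hm : Measurable fun u : Fin (n + 1) → α => ∏ i, g i (u i) :=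
      Finset.measurable_fun_prod _ fun i _ => (hg i).comp (measurable_pi_apply i)
    have hm' : Measurable fun u : Fin n → α => ∏ i, g i.succ (u i) :=
      Finset.measurable_fun_prod _ fun i _ => (hg i.succ).comp (measurable_pi_apply i)
    rw [lintegral_pi_succ ν hm, Fin.prod_univ_succ]
    simp only [Fin.prod_univ_succ, Fin.cons_zero, Fin.cons_succ]
    simp_rw [lintegral_const_mul _ hm', ih (fun j => ν j.succ) fun j => hg j.succ]
    rw [lintegral_mul_const _ (hg 0)]

/-- Increasing events are positively correlated under a product measure. -/
theorem measureReal_mul_le_inter_of_isUpperSet {α : Type*} [LinearOrder α] [MeasurableSpace α]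
    {n : ℕ} (ν : Fin n → Measure α) [∀ i, IsProbabilityMeasure (ν i)]
    {A B : Set (Fin n → α)} (hA : IsUpperSet A) (hB : IsUpperSet B)
    (hAm : MeasurableSet A) (hBm : MeasurableSet B) :
    (Measure.pi ν).real A * (Measure.pi ν).real B ≤ (Measure.pi ν).real (A ∩ B) := by
  have mono : ∀ {S : Set (Fin n → α)}, IsUpperSet S →
      Monotone (S.indicator (1 : (Fin n → α) → ℝ≥0∞)) := by
    intro S hS u v huv
    by_cases hu : u ∈ S
    · simp [hu, hS huv hu]
    · simp [hu]
  have h := lintegral_mul_lintegral_le_of_monotone_pi ν (mono hA) (mono hB)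
    (measurable_one.indicator hAm) (measurable_one.indicator hBm)
  have e : ∀ u, A.indicator (1 : (Fin n → α) → ℝ≥0∞) u * B.indicator 1 u
      = (A ∩ B).indicator 1 u := fun u => by
    rw [Set.inter_indicator_one]; rfl
  simp only [e] at h
  rw [lintegral_indicator_one hAm, lintegral_indicator_one hBm,
    lintegral_indicator_one (hAm.inter hBm)] at h
  simp only [Measure.real]
  rw [← ENNReal.toReal_mul]
  exact ENNReal.toReal_mono (measure_ne_top _ _) h

/-! ### Splitting a family of unlikely events -/

/-- A discrete intermediate value argument: adding one event raises the probability of the union by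
at most δ, so the level c is overshot by at most δ when it is first reached. -/
theorem exists_subset_measureReal_biUnion_mem_Icc {Ω ι : Type*} [MeasurableSpace Ω] [DecidableEq ι]
    (P : Measure Ω) [IsFiniteMeasure P] (I : ι → Set Ω) {δ c : ℝ} (hδ : 0 ≤ δ) (hc : 0 ≤ c)
    (s : Finset ι) (hI : ∀ i ∈ s, P.real (I i) ≤ δ) (hs : c ≤ P.real (⋃ i ∈ s, I i)) :
    ∃ t ⊆ s, P.real (⋃ i ∈ t, I i) ∈ Set.Icc c (c + δ) := by
  induction s using Finset.induction_on with
  | empty => exact ⟨∅, le_rfl, hs, by simpa using by positivity⟩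
  | insert a s _ ih =>
    by_cases h : c ≤ P.real (⋃ i ∈ s, I i)
    · obtain ⟨t, ht, h'⟩ := ih (fun i hi => hI i (Finset.mem_insert_of_mem hi)) h
      exact ⟨t, ht.trans (Finset.subset_insert _ _), h'⟩
    · refine ⟨_, le_rfl, hs, ?_⟩
      rw [Finset.set_biUnion_insert]
      refine (measureReal_union_le _ _).trans ?_
      linarith [hI a (Finset.mem_insert_self _ _)]

theorem setOf_le_ncard_eq_biUnion {Ω κ : Type*} (S : Finset κ) (E : κ → Set Ω) (L : ℕ) :
    {u | L ≤ Set.ncard {s | s ∈ S ∧ u ∈ E s}} = ⋃ T ∈ S.powersetCard L, ⋂ s ∈ T, E s := by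
  have fin : ∀ u, {s | s ∈ S ∧ u ∈ E s}.Finite := fun u =>
    S.finite_toSet.subset fun s hs => hs.1
  ext u
  simp only [Set.mem_ofPred_eq, Set.mem_iUnion, exists_prop, Set.mem_iInter,
    Finset.mem_powersetCard]
  constructor
  · intro h
    obtain ⟨t, ht, htc⟩ := Set.exists_subset_card_eq h
    have htf := (fin u).subset ht
    refine ⟨htf.toFinset, ⟨fun s hs => (ht (htf.mem_toFinset.1 hs)).1, ?_⟩,
      fun s hs => (ht (htf.mem_toFinset.1 hs)).2⟩
    rw [← htc, Set.ncard_eq_toFinset_card _ htf]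
  · rintro ⟨T, ⟨hTS, hTc⟩, hT⟩
    rw [← hTc, ← Set.ncard_coe_finset]
    exact Set.ncard_le_ncard (fun s hs => ⟨hTS hs, hT s hs⟩) (fin u)

theorem measurableSet_le_ncard {Ω κ : Type*} [MeasurableSpace Ω] (S : Finset κ) {E : κ → Set Ω}
    (hE : ∀ s, MeasurableSet (E s)) (L : ℕ) :
    MeasurableSet {u | L ≤ Set.ncard {s | s ∈ S ∧ u ∈ E s}} := by
  rw [setOf_le_ncard_eq_biUnion]
  exact Finset.measurableSet_biUnion _ fun T _ => Finset.measurableSet_biInter _ fun s _ => hE s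

/-- If the events `E s` are increasing, measurable and unlikely, then the probability that `L + 1`
of them occur is nearly bounded below by a quarter of the square of the probability that `L` of them
occur. -/
theorem sq_measureReal_le_card_div_four_sub_le {α κ : Type*} [LinearOrder α] [MeasurableSpace α]
    {n : ℕ} (ν : Fin n → Measure α) [∀ i, IsProbabilityMeasure (ν i)] (S : Finset κ)
    (E : κ → Set (Fin n → α)) (hE : ∀ s, IsUpperSet (E s)) (hEm : ∀ s, MeasurableSet (E s))
    {δ : ℝ} (hδ : 0 ≤ δ) (hEδ : ∀ s ∈ S, (Measure.pi ν).real (E s) ≤ δ) {L : ℕ} (hL : 1 ≤ L) :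
    (Measure.pi ν).real {u | L ≤ Set.ncard {s | s ∈ S ∧ u ∈ E s}} ^ 2 / 4 - δ ≤
      (Measure.pi ν).real {u | L + 1 ≤ Set.ncard {s | s ∈ S ∧ u ∈ E s}} := by
  classical
  set P := Measure.pi ν
  set I : Finset κ → Set (Fin n → α) := fun T => ⋂ s ∈ T, E s with hI
  have fin : ∀ u, {s | s ∈ S ∧ u ∈ E s}.Finite := fun u =>
    S.finite_toSet.subset fun s hs => hs.1
  have hU : {u | L ≤ Set.ncard {s | s ∈ S ∧ u ∈ E s}} = ⋃ T ∈ S.powersetCard L, I T :=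
    setOf_le_ncard_eq_biUnion S E L
  have hIu : ∀ T, IsUpperSet (I T) := fun T =>
    isUpperSet_iInter fun s => isUpperSet_iInter fun _ => hE s
  have hIm : ∀ T, MeasurableSet (I T) := fun T =>
    Finset.measurableSet_biInter _ fun s _ => hEm s
  have hIδ : ∀ T ∈ S.powersetCard L, P.real (I T) ≤ δ := by
    intro T hT
    rw [Finset.mem_powersetCard] at hT
    obtain ⟨s, hs⟩ : T.Nonempty := by
      rw [← Finset.card_pos]; omega
    exact (measureReal_mono (Set.biInter_subset_of_mem hs)).trans (hEδ s (hT.1 hs))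
  set p := P.real {u | L ≤ Set.ncard {s | s ∈ S ∧ u ∈ E s}} with hp
  have hp0 : 0 ≤ p := measureReal_nonneg
  have hp1 : p ≤ 1 := measureReal_le_one
  obtain ⟨t, hts, ht1, ht2⟩ := exists_subset_measureReal_biUnion_mem_Icc P I hδ
    (by positivity : 0 ≤ p / 2) (S.powersetCard L) hIδ (by rw [← hU]; linarith)
  set A := ⋃ T ∈ t, I T with hA
  set B := ⋃ T ∈ S.powersetCard L \ t, I T with hB
  -- As A has probability at most p/2 + δ, the remaining L-sets carry at least p/2 - δ.
  have hAB : p ≤ P.real A + P.real B := by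
    rw [hp, hU, ← Finset.union_sdiff_of_subset hts, Finset.set_biUnion_union]
    exact measureReal_union_le _ _
  have hcorr : P.real A * P.real B ≤ P.real (A ∩ B) :=
    measureReal_mul_le_inter_of_isUpperSet ν
      (isUpperSet_iUnion fun T => isUpperSet_iUnion fun _ => hIu T)
      (isUpperSet_iUnion fun T => isUpperSet_iUnion fun _ => hIu T)
      (Finset.measurableSet_biUnion _ fun T _ => hIm T)
      (Finset.measurableSet_biUnion _ fun T _ => hIm T)
  -- The two L-sets come from complementary classes, hence differ, and their union has more than L
  -- elements.
  have hsub : A ∩ B ⊆ {u | L + 1 ≤ Set.ncard {s | s ∈ S ∧ u ∈ E s}} := by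
    rintro u ⟨hu1, hu2⟩
    simp only [hA, hB, Set.mem_iUnion, exists_prop, hI, Set.mem_iInter, Finset.mem_sdiff,
      Finset.mem_powersetCard] at hu1 hu2
    obtain ⟨T, hT, huT⟩ := hu1
    obtain ⟨T', ⟨⟨hT'S, hT'c⟩, hT'⟩, huT'⟩ := hu2
    have hTc := Finset.mem_powersetCard.1 (hts hT)
    have hne : T ≠ T' := by rintro rfl; exact hT' hT
    have hlt : L < (T ∪ T').card := by
      rw [← hTc.2]
      refine Finset.card_lt_card ⟨Finset.subset_union_left, fun h => hne ?_⟩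
      exact (Finset.eq_of_subset_of_card_le (Finset.subset_union_right.trans h)
        (by rw [hTc.2, hT'c])).symm
    have : ((T ∪ T' : Finset κ) : Set κ).ncard ≤ Set.ncard {s | s ∈ S ∧ u ∈ E s} := by
      refine Set.ncard_le_ncard (fun s hs => ?_) (fin u)
      rcases Finset.mem_union.1 (Finset.mem_coe.1 hs) with h | h
      · exact ⟨hTc.1 h, huT s h⟩
      · exact ⟨hT'S h, huT' s h⟩
    rw [Set.ncard_coe_finset] at this
    exact (Nat.succ_le_of_lt hlt).trans this
  have hB0 : 0 ≤ P.real B := measureReal_nonneg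
  refine le_trans ?_ (hcorr.trans (measureReal_mono hsub))
  have h1 : p / 2 - δ ≤ P.real B := by linarith
  have h2 : p / 2 * P.real B ≤ P.real A * P.real B := mul_le_mul_of_nonneg_right ht1 hB0
  nlinarith

namespace BinaryChannel

variable (W : BinaryChannel.{u})

/-! ### List decoding of a fixed code -/

instance isProbabilityMeasure_law (x : ZMod 2) : IsProbabilityMeasure (W.law x) :=
  ⟨by rw [law, withDensity_apply _ .univ, Measure.restrict_univ, W.lintegral_density]⟩

/-- The likelihood ratio of the wrong input and the input `x`. -/
noncomputable def likelihoodRatio (x : ZMod 2) (y : W.Out) : ℝ≥0 :=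
  W.density (x + 1) y / W.density x y

theorem measurable_likelihoodRatio (x : ZMod 2) : Measurable (W.likelihoodRatio x) :=
  (W.measurable_density _).div (W.measurable_density _)

theorem integrable_density (x : ZMod 2) : Integrable (fun y => (W.density x y : ℝ)) W.ref := by
  have h := W.measurable_density x
  refine ⟨by fun_prop, ?_⟩
  rw [hasFiniteIntegral_iff_ofReal (ae_of_all _ fun y => NNReal.coe_nonneg _)]
  simp [W.lintegral_density]

theorem integral_density (x : ZMod 2) : ∫ y, (W.density x y : ℝ) ∂W.ref = 1 := by
  have h := W.measurable_density x
  rw [integral_eq_lintegral_of_nonneg_ae (ae_of_all _ fun y => NNReal.coe_nonneg _) (by fun_prop)]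
  simp [W.lintegral_density]

theorem integrable_sqrt_density :
    Integrable (fun y => √((W.density 0 y : ℝ) * (W.density 1 y : ℝ))) W.ref := by
  have h := W.measurable_density
  refine ((W.integrable_density 0).add (W.integrable_density 1)).mono' (by fun_prop)
    (ae_of_all _ fun y => ?_)
  rw [Real.norm_of_nonneg (Real.sqrt_nonneg _)]
  refine Real.sqrt_le_iff.2 ⟨add_nonneg (NNReal.coe_nonneg _) (NNReal.coe_nonneg _), ?_⟩
  simp only [Pi.add_apply]
  nlinarith [(W.density 0 y).coe_nonneg, (W.density 1 y).coe_nonneg,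
    mul_nonneg (W.density 0 y).coe_nonneg (W.density 1 y).coe_nonneg]

/-- Weighting the root of the ratio by W(y|x) gives √(W(y|0) W(y|1)), whichever input x is. Where
W(y|x) = 0 both sides vanish, consistently with division by zero being zero. -/
theorem lintegral_sqrt_likelihoodRatio (x : ZMod 2) :
    ∫⁻ y, (NNReal.sqrt (W.likelihoodRatio x y) : ℝ≥0∞) ∂(W.law x) =
      ENNReal.ofReal W.bhattacharyya := by
  have hm := W.measurable_density x
  have hr := W.measurable_likelihoodRatio x
  rw [law, lintegral_withDensity_eq_lintegral_mul _ (by fun_prop) (by fun_prop), bhattacharyya,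
    ofReal_integral_eq_lintegral_ofReal W.integrable_sqrt_density
      (ae_of_all _ fun y => Real.sqrt_nonneg _)]
  refine lintegral_congr fun y => ?_
  have e : (W.density 0 y : ℝ) * W.density 1 y = W.density x y * W.density (x + 1) y := by
    have hx : ∀ x : ZMod 2, x = 0 ∨ x = 1 := by decide
    rcases hx x with rfl | rfl
    · rw [zero_add]
    · exact mul_comm _ _
  rw [e, ← NNReal.coe_mul, ← Real.coe_sqrt, ENNReal.ofReal_coe_nnreal, Pi.mul_apply,
    ← ENNReal.coe_mul, likelihoodRatio]
  congr 1
  by_cases h : W.density x y = 0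
  · simp [h]
  · rw [NNReal.sqrt_div, NNReal.sqrt_mul, mul_div_assoc']
    rw [div_eq_iff (by simpa using h), mul_right_comm, NNReal.mul_self_sqrt]

/-- This makes the value 0 given to a ratio with zero denominator harmless. -/
theorem ae_density_ne_zero {N : ℕ} (x : Fin N → ZMod 2) :
    ∀ᵐ y ∂(Measure.pi fun i => W.law (x i)), ∀ i, W.density (x i) (y i) ≠ 0 := by
  refine eventually_all.2 fun i => ?_
  have h : ∀ᵐ a ∂(W.law (x i)), W.density (x i) a ≠ 0 := by
    rw [law, ae_withDensity_iff (by have := W.measurable_density (x i); fun_prop)]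
    exact ae_of_all _ fun a ha => by simpa using ha
  exact (Measure.quasiMeasurePreserving_eval (μ := fun i => W.law (x i)) i).ae h

/-- The event, in terms of the likelihood ratios, that `x'` is at least as likely as `x`. -/
def ratioEvent {N : ℕ} (x x' : Fin N → ZMod 2) : Set (Fin N → ℝ≥0) :=
  {u | 1 ≤ ∏ i, if x' i = x i then 1 else u i}

/-- Since ratios are taken against the symbols of x, all competitors profit from the same direction
of change. This common monotonicity is what Harris' inequality needs. -/
theorem isUpperSet_ratioEvent {N : ℕ} (x x' : Fin N → ZMod 2) : IsUpperSet (ratioEvent x x') := by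
  intro u v huv hu
  refine le_trans (Set.mem_ofPred_eq ▸ hu) (Finset.prod_le_prod' fun i _ => ?_)
  split_ifs
  · exact le_rfl
  · exact huv i

theorem measurableSet_ratioEvent {N : ℕ} (x x' : Fin N → ZMod 2) :
    MeasurableSet (ratioEvent x x') := by
  refine measurableSet_le measurable_const (Finset.measurable_fun_prod _ fun i _ => ?_)
  split_ifs <;> fun_prop

theorem likelihood_le_iff {N : ℕ} {x : Fin N → ZMod 2} (x' : Fin N → ZMod 2) {y : Fin N → W.Out}
    (hy : ∀ i, W.density (x i) (y i) ≠ 0) :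
    W.likelihood y x ≤ W.likelihood y x' ↔
      (fun i => W.likelihoodRatio (x i) (y i)) ∈ ratioEvent x x' := by
  have h : W.likelihood y x' = W.likelihood y x *
      ∏ i, if x' i = x i then 1 else W.likelihoodRatio (x i) (y i) := by
    rw [likelihood, likelihood, ← Finset.prod_mul_distrib]
    refine Finset.prod_congr rfl fun i _ => ?_
    split_ifs with hi
    · rw [hi, mul_one]
    · have : x' i = x i + 1 := by
        generalize x' i = a at hi ⊢
        generalize x i = b at hi ⊢
        revert a b
        decide
      rw [likelihoodRatio, this, mul_div_cancel₀ _ (hy i)]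
  have h0 : 0 < W.likelihood y x := Finset.prod_pos fun i _ => pos_iff_ne_zero.2 (hy i)
  rw [h, ratioEvent, Set.mem_ofPred_eq, le_mul_iff_one_le_right h0]

/-- The law of the likelihood ratios when `x` is transmitted. -/
noncomputable def ratioLaw {N : ℕ} (x : Fin N → ZMod 2) (i : Fin N) : Measure ℝ≥0 :=
  (W.law (x i)).map (W.likelihoodRatio (x i))

instance {N : ℕ} (x : Fin N → ZMod 2) (i : Fin N) : IsProbabilityMeasure (W.ratioLaw x i) :=
  Measure.isProbabilityMeasure_map (W.measurable_likelihoodRatio _).aemeasurable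

theorem pi_ratioLaw {N : ℕ} (x : Fin N → ZMod 2) :
    Measure.pi (W.ratioLaw x) = (Measure.pi fun i => W.law (x i)).map
      (fun y i => W.likelihoodRatio (x i) (y i)) := by
  have : ∀ i, SigmaFinite ((W.law (x i)).map (W.likelihoodRatio (x i))) := fun i =>
    inferInstanceAs (SigmaFinite (W.ratioLaw x i))
  exact (Measure.pi_map_pi fun i => (W.measurable_likelihoodRatio (x i)).aemeasurable).symm

theorem bhattacharyya_nonneg : 0 ≤ W.bhattacharyya :=
  integral_nonneg fun _ => Real.sqrt_nonneg _

/-- The Bhattacharyya bound: the indicator that a product is at least 1 is at most the root of the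
product, whose expectation factors over coordinates, with a factor Z wherever the words differ. -/
theorem measureReal_ratioEvent_le {N : ℕ} (x x' : Fin N → ZMod 2) :
    (Measure.pi (W.ratioLaw x)).real (ratioEvent x x') ≤
      W.bhattacharyya ^ hammingNorm (x' - x) := by
  set g : Fin N → ℝ≥0 → ℝ≥0∞ := fun i a => if x' i = x i then 1 else (NNReal.sqrt a : ℝ≥0∞)
  have hg : ∀ i, Measurable (g i) := by
    intro i
    simp only [g]
    split_ifs <;> fun_prop
  have h1 : (Measure.pi (W.ratioLaw x)) (ratioEvent x x') ≤
      ∫⁻ u, ∏ i, g i (u i) ∂(Measure.pi (W.ratioLaw x)) := by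
    rw [← lintegral_indicator_one (measurableSet_ratioEvent x x')]
    refine lintegral_mono fun u => ?_
    by_cases hu : u ∈ ratioEvent x x'
    · rw [Set.indicator_of_mem hu]
      have e : ∏ i, g i (u i) = (NNReal.sqrt (∏ i, if x' i = x i then 1 else u i) : ℝ≥0∞) := by
        rw [show NNReal.sqrt (∏ i, if x' i = x i then 1 else u i) =
          ∏ i, NNReal.sqrt (if x' i = x i then 1 else u i) from map_prod NNReal.sqrtHom _ _,
          ENNReal.ofNNReal_finsetProd]
        refine Finset.prod_congr rfl fun i _ => ?_
        simp only [g]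
        split_ifs <;> simp
      rw [e, Pi.one_apply, ← ENNReal.coe_one, ENNReal.coe_le_coe]
      exact NNReal.sqrt_one.symm.le.trans (NNReal.sqrt_le_sqrt.2 hu)
    · rw [Set.indicator_of_notMem hu]
      exact zero_le
  have h2 : ∀ i, ∫⁻ a, g i a ∂(W.ratioLaw x i) =
      if x' i = x i then 1 else ENNReal.ofReal W.bhattacharyya := by
    intro i
    simp only [g]
    split_ifs with h
    · simp
    · rw [ratioLaw, lintegral_map (by fun_prop) (W.measurable_likelihoodRatio _),
        lintegral_sqrt_likelihoodRatio]
  rw [lintegral_pi_prod _ hg] at h1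
  simp only [h2] at h1
  rw [Finset.prod_ite, Finset.prod_const_one, one_mul, Finset.prod_const,
    ← ENNReal.ofReal_pow W.bhattacharyya_nonneg] at h1
  have h3 : hammingNorm (x' - x) = (Finset.univ.filter fun i => ¬ x' i = x i).card := by
    simp [hammingNorm, sub_eq_zero]
  rw [h3]
  exact ENNReal.toReal_le_of_le_ofReal (pow_nonneg W.bhattacharyya_nonneg _) h1

/-- The probability that at least `L` words of `D` other than the transmitted word `x` are at least
as likely as `x`. -/
noncomputable def wordListError {N : ℕ} (D : Submodule (ZMod 2) (Fin N → ZMod 2)) (L : ℕ)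
    (x : Fin N → ZMod 2) : ℝ :=
  (Measure.pi fun i => W.law (x i)).real
      {y | L ≤ Set.ncard {x' : Fin N → ZMod 2 |
        x' ∈ D ∧ x' ≠ x ∧ W.likelihood y x ≤ W.likelihood y x'}}

/-- Transports the splitting inequality to the channel. A competitor differs from x by a nonzero
codeword, so δ can be taken to be Z^d. -/
theorem sq_wordListError_div_four_sub_le {N : ℕ} {D : Submodule (ZMod 2) (Fin N → ZMod 2)}
    {d : ℕ} (hZ : W.bhattacharyya ≤ 1) (hD : ∀ c ∈ D, c ≠ 0 → d ≤ hammingNorm c) {L : ℕ}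
    (hL : 1 ≤ L) {x : Fin N → ZMod 2} (hx : x ∈ D) :
    W.wordListError D L x ^ 2 / 4 - W.bhattacharyya ^ d ≤ W.wordListError D (L + 1) x := by
  classical
  set S : Finset (Fin N → ZMod 2) := Finset.univ.filter fun x' => x' ∈ D ∧ x' ≠ x
  have key : ∀ l, W.wordListError D l x = (Measure.pi (W.ratioLaw x)).real
      {u | l ≤ Set.ncard {s | s ∈ S ∧ u ∈ ratioEvent x s}} := by
    intro l
    have hm : Measurable fun (y : Fin N → W.Out) i => W.likelihoodRatio (x i) (y i) :=
      measurable_pi_lambda _ fun i => (W.measurable_likelihoodRatio (x i)).comp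
        (measurable_pi_apply i)
    rw [pi_ratioLaw, map_measureReal_apply hm (measurableSet_le_ncard S (measurableSet_ratioEvent x) l)]
    refine measureReal_congr ?_
    filter_upwards [W.ae_density_ne_zero x] with y hy
    refine propext ?_
    change l ≤ Set.ncard _ ↔ l ≤ Set.ncard _
    simp only [W.likelihood_le_iff _ hy, S, Finset.mem_filter, Finset.mem_univ, true_and, and_assoc]
  rw [key, key]
  refine sq_measureReal_le_card_div_four_sub_le _ S _ (isUpperSet_ratioEvent x)
    (measurableSet_ratioEvent x) (pow_nonneg W.bhattacharyya_nonneg _) (fun s hs => ?_) hL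
  simp only [S, Finset.mem_filter, Finset.mem_univ, true_and] at hs
  exact (W.measureReal_ratioEvent_le x s).trans (pow_le_pow_of_le_one W.bhattacharyya_nonneg hZ
    (hD _ (D.sub_mem hs.1 hx) (sub_ne_zero.2 hs.2)))

open Classical in
theorem mapListError_eq {N : ℕ} (D : Submodule (ZMod 2) (Fin N → ZMod 2)) (L : ℕ) :
    W.mapListError D L = (∑ x ∈ Finset.univ.filter (fun x : Fin N → ZMod 2 => x ∈ D),
      W.wordListError D L x) / (Finset.univ.filter (fun x : Fin N → ZMod 2 => x ∈ D)).card := by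
  rw [mapListError, Nat.card_eq_fintype_card, Fintype.card_subtype]
  rfl

theorem mapListError_mem_Icc {N : ℕ} (D : Submodule (ZMod 2) (Fin N → ZMod 2)) (L : ℕ) :
    W.mapListError D L ∈ Set.Icc (0 : ℝ) 1 := by
  classical
  rw [mapListError_eq]
  refine ⟨div_nonneg (Finset.sum_nonneg fun _ _ => measureReal_nonneg) (Nat.cast_nonneg _),
    div_le_one_of_le₀ ?_ (Nat.cast_nonneg _)⟩
  refine (Finset.sum_le_card_nsmul _ _ 1 fun x _ => measureReal_le_one).trans ?_
  simp

theorem mapListError_anti {N : ℕ} (D : Submodule (ZMod 2) (Fin N → ZMod 2)) {L L' : ℕ}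
    (h : L ≤ L') : W.mapListError D L' ≤ W.mapListError D L := by
  classical
  rw [mapListError_eq, mapListError_eq]
  refine div_le_div_of_nonneg_right (Finset.sum_le_sum fun x _ => ?_) (Nat.cast_nonneg _)
  exact measureReal_mono fun y hy => h.trans hy

/-- Averages the bound for single words, the mean of squares being at least the square of the mean.
-/
theorem sq_mapListError_div_four_sub_le {N : ℕ} {D : Submodule (ZMod 2) (Fin N → ZMod 2)}
    {d : ℕ} (hZ : W.bhattacharyya ≤ 1) (hD : ∀ c ∈ D, c ≠ 0 → d ≤ hammingNorm c) {L : ℕ}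
    (hL : 1 ≤ L) :
    W.mapListError D L ^ 2 / 4 - W.bhattacharyya ^ d ≤ W.mapListError D (L + 1) := by
  classical
  rw [mapListError_eq, mapListError_eq]
  set S := Finset.univ.filter (fun x : Fin N → ZMod 2 => x ∈ D) with hS
  have hc : (0 : ℝ) < S.card := by
    exact_mod_cast Finset.card_pos.2 ⟨0, by simp [hS]⟩
  have h1 : ∑ x ∈ S, (W.wordListError D L x ^ 2 / 4 - W.bhattacharyya ^ d) ≤
      ∑ x ∈ S, W.wordListError D (L + 1) x := Finset.sum_le_sum fun x hx =>
    W.sq_wordListError_div_four_sub_le hZ hD hL (by simpa [hS] using hx)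
  rw [Finset.sum_sub_distrib, ← Finset.sum_div, Finset.sum_const, nsmul_eq_mul] at h1
  have h2 : (∑ x ∈ S, W.wordListError D L x) ^ 2 ≤
      S.card * ∑ x ∈ S, W.wordListError D L x ^ 2 := sq_sum_le_card_mul_sum_sq
  rw [le_div_iff₀ hc]
  refine le_trans ?_ h1
  rw [sub_mul, div_pow]
  have h3 : (∑ x ∈ S, W.wordListError D L x) ^ 2 / (S.card : ℝ) ^ 2 / 4 * S.card =
      (∑ x ∈ S, W.wordListError D L x) ^ 2 / S.card / 4 := by
    field_simp
  rw [h3, mul_comm (W.bhattacharyya ^ d)]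
  refine sub_le_sub_right (div_le_div_of_nonneg_right ?_ (by norm_num)) _
  rwa [div_le_iff₀ hc, mul_comm]

end BinaryChannel

/-! ### Total variation of products of densities -/

section Densities

variable {α : Type*} [MeasurableSpace α] {ρ : Measure α} {f g f' g' : α → ℝ}

/-- Forgetting the second output, that is integrating it out inside the absolute value, cannot
increase the distance. -/
theorem integral_abs_sub_le_integral_abs_prod_sub [SigmaFinite ρ] (hf : Integrable f ρ) (hg : Integrable g ρ)
    (hf' : Integrable f' ρ) (hg' : Integrable g' ρ) (hf1' : ∫ y, f' y ∂ρ = 1)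
    (hg1' : ∫ y, g' y ∂ρ = 1) :
    ∫ y, |f y - g y| ∂ρ ≤ ∫ y : α × α, |f y.1 * f' y.2 - g y.1 * g' y.2| ∂(ρ.prod ρ) := by
  have hi : Integrable (fun y : α × α => |f y.1 * f' y.2 - g y.1 * g' y.2|) (ρ.prod ρ) :=
    ((hf.mul_prod hf').sub (hg.mul_prod hg')).abs
  rw [integral_prod _ hi]
  refine integral_mono (hf.sub hg).abs hi.integral_prod_left fun y => ?_
  have : f y - g y = ∫ z, (f y * f' z - g y * g' z) ∂ρ := by
    rw [integral_sub (hf'.const_mul _) (hg'.const_mul _), integral_const_mul, integral_const_mul,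
      hf1', hg1', mul_one, mul_one]
  dsimp only
  rw [this]
  exact abs_integral_le_integral_abs

theorem integral_min_eq (hf : Integrable f ρ) (hg : Integrable g ρ) (hf1 : ∫ y, f y ∂ρ = 1)
    (hg1 : ∫ y, g y ∂ρ = 1) :
    ∫ y, min (f y) (g y) ∂ρ = 1 - (∫ y, |f y - g y| ∂ρ) / 2 := by
  have h : ∀ y, min (f y) (g y) = (f y + g y - |f y - g y|) / 2 := by
    intro y
    linarith [min_add_max (f y) (g y), max_sub_min_eq_abs' (f y) (g y)]
  have hs : Integrable (fun y => f y + g y) ρ := hf.add hg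
  have hd : Integrable (fun y => |f y - g y|) ρ := (hf.sub hg).abs
  simp only [h]
  rw [integral_div, integral_sub hs hd, integral_add hf hg, hf1, hg1]
  ring

/-- The product of the two pointwise minima lies below both product densities, so the overlap of the
products is at least the product of the overlaps. -/
theorem integral_abs_prod_sub_le [SigmaFinite ρ] (hf : Integrable f ρ) (hg : Integrable g ρ)
    (hf' : Integrable f' ρ) (hg' : Integrable g' ρ) (hf1 : ∫ y, f y ∂ρ = 1)
    (hg1 : ∫ y, g y ∂ρ = 1) (hf1' : ∫ y, f' y ∂ρ = 1) (hg1' : ∫ y, g' y ∂ρ = 1)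
    (hf0 : ∀ y, 0 ≤ f y) (hg0 : ∀ y, 0 ≤ g y) (hf0' : ∀ y, 0 ≤ f' y) (hg0' : ∀ y, 0 ≤ g' y) :
    ∫ y : α × α, |f y.1 * f' y.2 - g y.1 * g' y.2| ∂(ρ.prod ρ) ≤
      2 - 2 * ((1 - (∫ y, |f y - g y| ∂ρ) / 2) * (1 - (∫ y, |f' y - g' y| ∂ρ) / 2)) := by
  rw [← integral_min_eq hf hg hf1 hg1, ← integral_min_eq hf' hg' hf1' hg1', ← integral_prod_mul]
  have hm : Integrable (fun y : α × α => min (f y.1) (g y.1) * min (f' y.2) (g' y.2)) (ρ.prod ρ) :=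
    (hf.inf hg).mul_prod (hf'.inf hg')
  have hs : Integrable (fun y : α × α => f y.1 * f' y.2 + g y.1 * g' y.2) (ρ.prod ρ) :=
    (hf.mul_prod hf').add (hg.mul_prod hg')
  have e : (2 : ℝ) = ∫ y : α × α, (f y.1 * f' y.2 + g y.1 * g' y.2) ∂(ρ.prod ρ) := by
    rw [integral_add (hf.mul_prod hf') (hg.mul_prod hg'), integral_prod_mul, integral_prod_mul,
      hf1, hg1, hf1', hg1']
    norm_num
  have h2 : ∫ y : α × α, (f y.1 * f' y.2 + g y.1 * g' y.2
      - 2 * (min (f y.1) (g y.1) * min (f' y.2) (g' y.2))) ∂(ρ.prod ρ) =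
      2 - 2 * ∫ y : α × α, min (f y.1) (g y.1) * min (f' y.2) (g' y.2) ∂(ρ.prod ρ) := by
    rw [integral_sub hs (hm.const_mul _), ← e,
      integral_const_mul]
  rw [← h2]
  refine integral_mono ((hf.mul_prod hf').sub (hg.mul_prod hg')).abs
    (hs.sub (hm.const_mul _)) fun y => ?_
  have h0 : 0 ≤ min (f' y.2) (g' y.2) := le_min (hf0' _) (hg0' _)
  have h1 : min (f y.1) (g y.1) * min (f' y.2) (g' y.2) ≤ f y.1 * f' y.2 :=
    mul_le_mul (min_le_left _ _) (min_le_left _ _) h0 (hf0 _)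
  have h3 : min (f y.1) (g y.1) * min (f' y.2) (g' y.2) ≤ g y.1 * g' y.2 :=
    mul_le_mul (min_le_right _ _) (min_le_right _ _) h0 (hg0 _)
  exact abs_le.2 ⟨by dsimp only; linarith, by dsimp only; linarith⟩

end Densities

/-! ### Total variation, Bhattacharyya parameter and the polar transforms -/

namespace BinaryChannel

variable (W : BinaryChannel.{u})

/-- The total variation distance of the output laws of the two inputs. -/
noncomputable def totalVariation : ℝ :=
  (∫ y, |(W.density 0 y : ℝ) - W.density 1 y| ∂W.ref) / 2

theorem totalVariation_nonneg : 0 ≤ W.totalVariation :=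
  div_nonneg (integral_nonneg fun _ => abs_nonneg _) zero_le_two

theorem integral_min_density :
    ∫ y, min (W.density 0 y : ℝ) (W.density 1 y) ∂W.ref = 1 - W.totalVariation :=
  integral_min_eq (W.integrable_density 0) (W.integrable_density 1) (W.integral_density 0)
    (W.integral_density 1)

theorem totalVariation_le_one : W.totalVariation ≤ 1 := by
  have h : 0 ≤ ∫ y, min (W.density 0 y : ℝ) (W.density 1 y) ∂W.ref :=
    integral_nonneg fun y => le_min (NNReal.coe_nonneg _) (NNReal.coe_nonneg _)
  rw [integral_min_density] at h
  linarith

theorem one_sub_bhattacharyya_le_totalVariation : 1 - W.bhattacharyya ≤ W.totalVariation := by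
  have h : ∫ y, min (W.density 0 y : ℝ) (W.density 1 y) ∂W.ref ≤ W.bhattacharyya := by
    refine integral_mono ((W.integrable_density 0).inf (W.integrable_density 1))
      W.integrable_sqrt_density fun y => Real.le_sqrt_of_sq_le ?_
    rw [sq]
    exact mul_le_mul (min_le_left _ _) (min_le_right _ _)
      (le_min (NNReal.coe_nonneg _) (NNReal.coe_nonneg _)) (NNReal.coe_nonneg _)
  rw [integral_min_density] at h
  linarith

/-- Write |a - b| = |√a - √b| (√a + √b), apply the weighted AM-GM inequality and integrate. Keeping
t free replaces Cauchy–Schwarz; the next three results are specializations of t. -/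
theorem two_mul_totalVariation_le {t : ℝ} (ht : 0 < t) :
    2 * W.totalVariation ≤ t * (1 - W.bhattacharyya) + (1 + W.bhattacharyya) / t := by
  have h0 := W.integrable_density 0
  have h1 := W.integrable_density 1
  have hs := W.integrable_sqrt_density
  have h01 : Integrable (fun y => (W.density 0 y : ℝ) + W.density 1 y) W.ref := h0.add h1
  have key : ∫ y, |(W.density 0 y : ℝ) - W.density 1 y| ∂W.ref ≤
      ∫ y, ((t + 1 / t) / 2 * ((W.density 0 y : ℝ) + W.density 1 y) +
        (1 / t - t) * √((W.density 0 y : ℝ) * (W.density 1 y : ℝ))) ∂W.ref := by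
    refine integral_mono (h0.sub h1).abs ((h01.const_mul _).add (hs.const_mul _)) fun y => ?_
    dsimp only
    have ha := (W.density 0 y).coe_nonneg
    have hb := (W.density 1 y).coe_nonneg
    generalize (W.density 0 y : ℝ) = a at *
    generalize (W.density 1 y : ℝ) = b at *
    have hs2 := Real.sq_sqrt (mul_nonneg ha hb)
    have hs0 := Real.sqrt_nonneg (a * b)
    have hsl : 2 * √(a * b) ≤ a + b := by
      refine abs_le_of_sq_le_sq' ?_ (by positivity) |>.2
      nlinarith [sq_nonneg (a - b)]
    generalize √(a * b) = s at *
    have e : (t + 1 / t) / 2 * (a + b) + (1 / t - t) * s =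
        (t * (a + b - 2 * s) + (a + b + 2 * s) / t) / 2 := by
      field_simp
      ring
    rw [e]
    have hP : 0 ≤ t * (a + b - 2 * s) := mul_nonneg ht.le (by linarith)
    have hQ : 0 ≤ (a + b + 2 * s) / t := by positivity
    have hPQ : t * (a + b - 2 * s) * ((a + b + 2 * s) / t) = (a - b) ^ 2 := by
      field_simp
      nlinarith
    refine abs_le_of_sq_le_sq ?_ (by positivity)
    rw [← hPQ]
    nlinarith [sq_nonneg (t * (a + b - 2 * s) - (a + b + 2 * s) / t)]
  rw [integral_add (h01.const_mul _) (hs.const_mul _), integral_const_mul,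
    integral_const_mul, integral_add h0 h1, W.integral_density, W.integral_density] at key
  change _ ≤ _ + (1 / t - t) * W.bhattacharyya at key
  rw [totalVariation, mul_div_cancel₀ _ two_ne_zero]
  refine key.trans_eq ?_
  field_simp
  ring

theorem bhattacharyya_le_one : W.bhattacharyya ≤ 1 := by
  by_contra! h
  have h1 : 0 < W.bhattacharyya - 1 := sub_pos.2 h
  -- For Z > 1 this t makes the right-hand side equal to -2.
  have h2 := W.two_mul_totalVariation_le
    (t := (1 + W.bhattacharyya) / (W.bhattacharyya - 1)) (by positivity)
  have e : (1 + W.bhattacharyya) / (W.bhattacharyya - 1) * (1 - W.bhattacharyya) +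
      (1 + W.bhattacharyya) / ((1 + W.bhattacharyya) / (W.bhattacharyya - 1)) = -2 := by
    have : (1 + W.bhattacharyya) ≠ 0 := by positivity
    field_simp
    ring
  linarith [W.totalVariation_nonneg]

theorem totalVariation_sq_le : W.totalVariation ^ 2 ≤ 2 * (1 - W.bhattacharyya) := by
  have hZ := W.bhattacharyya_le_one
  rcases W.totalVariation_nonneg.eq_or_lt with h | h
  · rw [← h]
    linarith
  · have h1 := W.two_mul_totalVariation_le (t := 2 / W.totalVariation) (by positivity)
    have h2 := mul_le_mul_of_nonneg_right h1 h.le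
    have e : (2 / W.totalVariation * (1 - W.bhattacharyya) +
        (1 + W.bhattacharyya) / (2 / W.totalVariation)) * W.totalVariation =
        2 * (1 - W.bhattacharyya) + (1 + W.bhattacharyya) * W.totalVariation ^ 2 / 2 := by
      field_simp
    rw [e] at h2
    nlinarith [sq_nonneg W.totalVariation]

theorem totalVariation_lt_one (h : 0 < W.bhattacharyya) : W.totalVariation < 1 := by
  have h1 := W.two_mul_totalVariation_le (t := 1 + W.bhattacharyya) (by positivity)
  rw [div_self (by positivity)] at h1
  nlinarith

/-- The difference of the two transition densities factors as half the product of the differences at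
the two outputs. -/
theorem totalVariation_minus : W.minus.totalVariation = W.totalVariation ^ 2 := by
  have h : ∀ y : W.Out × W.Out, |(W.minus.density 0 y : ℝ) - W.minus.density 1 y| =
      2⁻¹ * (|(W.density 0 y.1 : ℝ) - W.density 1 y.1| *
        |(W.density 0 y.2 : ℝ) - W.density 1 y.2|) := by
    intro y
    have e : (W.minus.density 0 y : ℝ) - W.minus.density 1 y =
        2⁻¹ * (((W.density 0 y.1 : ℝ) - W.density 1 y.1) *
          ((W.density 0 y.2 : ℝ) - W.density 1 y.2)) := by
      have e2 : (1 + 1 : ZMod 2) = 0 := by decide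
      have e3 : ∀ k : ZMod 2 → ℝ≥0, ∑ v, k v = k 0 + k 1 := fun k => Fin.sum_univ_two k
      simp only [minus, e3, zero_add, add_zero, e2]
      push_cast
      ring
    rw [e, abs_mul, abs_mul, abs_of_pos (by norm_num : (0 : ℝ) < 2⁻¹)]
  change (∫ y : W.Out × W.Out, |(W.minus.density 0 y : ℝ) - W.minus.density 1 y|
    ∂(W.ref.prod W.ref)) / 2 = _
  simp only [h]
  rw [integral_const_mul,
    integral_prod_mul (fun y => |(W.density 0 y : ℝ) - W.density 1 y|)
      (fun y => |(W.density 0 y : ℝ) - W.density 1 y|), totalVariation]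
  ring

/-- Conditioning on the bit u₁ leaves two pairs of product densities; the plus channel averages
their distances. -/
theorem totalVariation_plus : W.plus.totalVariation =
    ((∫ y : W.Out × W.Out, |(W.density 0 y.1 : ℝ) * W.density 0 y.2 -
        W.density 1 y.1 * W.density 1 y.2| ∂(W.ref.prod W.ref)) +
      ∫ y : W.Out × W.Out, |(W.density 1 y.1 : ℝ) * W.density 0 y.2 -
        W.density 0 y.1 * W.density 1 y.2| ∂(W.ref.prod W.ref)) / 4 := by
  have hi : Integrable (fun y : (W.Out × W.Out) × Fin 2 =>
      |(W.plus.density 0 y : ℝ) - W.plus.density 1 y|)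
      ((W.ref.prod W.ref).prod Measure.count) :=
    ((W.plus.integrable_density 0).sub (W.plus.integrable_density 1)).abs
  have h0 : ∀ y : W.Out × W.Out,
      |(W.plus.density 0 (y, (0 : Fin 2)) : ℝ) - W.plus.density 1 (y, (0 : Fin 2))| =
      2⁻¹ * |(W.density 0 y.1 : ℝ) * W.density 0 y.2 - W.density 1 y.1 * W.density 1 y.2| := by
    intro y
    rw [← abs_of_pos (by norm_num : (0 : ℝ) < 2⁻¹), ← abs_mul]
    congr 1
    simp [plus]
    ring
  have h1 : ∀ y : W.Out × W.Out,
      |(W.plus.density 0 (y, (1 : Fin 2)) : ℝ) - W.plus.density 1 (y, (1 : Fin 2))| =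
      2⁻¹ * |(W.density 1 y.1 : ℝ) * W.density 0 y.2 - W.density 0 y.1 * W.density 1 y.2| := by
    intro y
    rw [← abs_of_pos (by norm_num : (0 : ℝ) < 2⁻¹), ← abs_mul]
    congr 1
    have e2 : (1 + 1 : ZMod 2) = 0 := by decide
    simp [plus, e2]
    ring
  change (∫ y : (W.Out × W.Out) × Fin 2, |(W.plus.density 0 y : ℝ) - W.plus.density 1 y|
    ∂((W.ref.prod W.ref).prod Measure.count)) / 2 = _
  rw [integral_prod_symm _ hi, integral_fintype Integrable.of_finite, Fin.sum_univ_two]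
  simp only [h0, h1, integral_const_mul]
  simp
  ring

theorem totalVariation_le_plus : W.totalVariation ≤ W.plus.totalVariation := by
  have i0 := W.integrable_density 0
  have i1 := W.integrable_density 1
  have e0 := W.integral_density 0
  have e1 := W.integral_density 1
  have h1 := integral_abs_sub_le_integral_abs_prod_sub i0 i1 i0 i1 e0 e1
  have h2 := integral_abs_sub_le_integral_abs_prod_sub i1 i0 i0 i1 e0 e1
  simp only [abs_sub_comm (W.density 1 _ : ℝ) (W.density 0 _ : ℝ)] at h2
  rw [totalVariation_plus, totalVariation]
  linarith

theorem totalVariation_plus_le :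
    W.plus.totalVariation ≤ 1 - (1 - W.totalVariation) ^ 2 := by
  have i0 := W.integrable_density 0
  have i1 := W.integrable_density 1
  have e0 := W.integral_density 0
  have e1 := W.integral_density 1
  have n0 : ∀ y, 0 ≤ (W.density 0 y : ℝ) := fun y => NNReal.coe_nonneg _
  have n1 : ∀ y, 0 ≤ (W.density 1 y : ℝ) := fun y => NNReal.coe_nonneg _
  have h1 := integral_abs_prod_sub_le i0 i1 i0 i1 e0 e1 e0 e1 n0 n1 n0 n1
  have h2 := integral_abs_prod_sub_le i1 i0 i0 i1 e1 e0 e0 e1 n1 n0 n0 n1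
  simp only [abs_sub_comm (W.density 1 _ : ℝ) (W.density 0 _ : ℝ)] at h2
  rw [totalVariation_plus]
  change _ ≤ 2 - 2 * ((1 - W.totalVariation) * (1 - W.totalVariation)) at h1
  change _ ≤ 2 - 2 * ((1 - W.totalVariation) * (1 - W.totalVariation)) at h2
  linarith

end BinaryChannel

/-! ### Binary weights and the reliability of the synthetic channels -/

/-- The number of ones among the `n` lowest binary digits of `i`. -/
def binaryWeight (n i : ℕ) : ℕ := ∑ t ∈ Finset.range n, i / 2 ^ t % 2

theorem binaryWeight_succ (n i : ℕ) :
    binaryWeight (n + 1) i = binaryWeight n (i / 2) + i % 2 := by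
  rw [binaryWeight, Finset.sum_range_succ', binaryWeight]
  simp [pow_succ', Nat.div_div_eq_div_mul]

theorem binaryWeight_le (n i : ℕ) : binaryWeight n i ≤ n := by
  refine (Finset.sum_le_card_nsmul _ _ 1 fun t _ => ?_).trans (by simp)
  omega

/-- In terms of the recursions x ↦ 1 - (1 - x)² and x ↦ x², the value is larger when the plus step
precedes the m minus steps. For one minus step the difference of the two sides is 2y²(1 - y)². -/
theorem one_sub_sq_pow_two_pow_le {x : ℝ} (m : ℕ) (hx0 : 0 ≤ x) (hx1 : x ≤ 1) :
    1 - (1 - x ^ 2 ^ m) ^ 2 ≤ (1 - (1 - x) ^ 2) ^ 2 ^ m := by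
  induction m with
  | zero => simp
  | succ m ih =>
    have hy0 : 0 ≤ x ^ 2 ^ m := by positivity
    have hy1 : x ^ 2 ^ m ≤ 1 := pow_le_one₀ hx0 hx1
    rw [pow_succ 2 m, pow_mul x, pow_mul (1 - (1 - x) ^ 2)]
    generalize x ^ 2 ^ m = y at *
    have h1 : 0 ≤ 1 - (1 - y) ^ 2 := by nlinarith
    refine le_trans ?_ (pow_le_pow_left₀ h1 ih 2)
    nlinarith [mul_nonneg (sq_nonneg y) (sq_nonneg (1 - y))]

namespace BinaryChannel

variable (W : BinaryChannel.{u})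

/-- A plus step does not lower the total variation and a minus step squares it, so only the number
of minus steps counts. -/
theorem pow_totalVariation_le_synthetic (n i : ℕ) :
    W.totalVariation ^ 2 ^ (n - binaryWeight n i) ≤ (W.synthetic n i).totalVariation := by
  induction n generalizing i with
  | zero => simp [synthetic]
  | succ n ih =>
    have hw := binaryWeight_le n (i / 2)
    rw [synthetic, binaryWeight_succ]
    split_ifs with h
    · rw [h, Nat.add_sub_add_right]
      exact (ih _).trans (totalVariation_le_plus _)
    · rw [show i % 2 = 0 by omega, add_zero, Nat.succ_sub hw, pow_succ 2, pow_mul,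
        totalVariation_minus]
      exact pow_le_pow_left₀ (pow_nonneg W.totalVariation_nonneg _) (ih _) 2

/-- The bound is the value for the most favourable order, all plus steps first. The exchange
inequality `one_sub_sq_pow_two_pow_le` restores this order after each new plus step. -/
theorem totalVariation_synthetic_le (n i : ℕ) :
    (W.synthetic n i).totalVariation ≤
      (1 - (1 - W.totalVariation) ^ 2 ^ binaryWeight n i) ^ 2 ^ (n - binaryWeight n i) := by
  have hT0 := W.totalVariation_nonneg
  have hT1 := W.totalVariation_le_one
  induction n generalizing i with
  | zero => simp [synthetic, binaryWeight]
  | succ n ih =>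
    have hw := binaryWeight_le n (i / 2)
    rw [synthetic, binaryWeight_succ]
    split_ifs with h
    · rw [h, Nat.add_sub_add_right]
      refine (totalVariation_plus_le _).trans ?_
      have h0 := (W.synthetic n (i / 2)).totalVariation_nonneg
      have h1 := ih (i / 2)
      set w := binaryWeight n (i / 2)
      have hx0 : 0 ≤ (1 - W.totalVariation) ^ 2 ^ w := pow_nonneg (by linarith) _
      have hx1 : (1 - W.totalVariation) ^ 2 ^ w ≤ 1 := pow_le_one₀ (by linarith) (by linarith)
      have key := one_sub_sq_pow_two_pow_le (x := 1 - (1 - W.totalVariation) ^ 2 ^ w) (n - w)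
        (by linarith) (by linarith)
      rw [sub_sub_cancel, ← pow_mul, ← pow_succ] at key
      refine le_trans ?_ key
      have h2 : (1 - (1 - W.totalVariation) ^ 2 ^ w) ^ 2 ^ (n - w) ≤ 1 :=
        pow_le_one₀ (by linarith) (by linarith)
      have h3 := pow_le_pow_left₀ (sub_nonneg.2 h2) (sub_le_sub_left h1 1) 2
      linarith
    · rw [show i % 2 = 0 by omega, add_zero, Nat.succ_sub hw, pow_succ 2 (n - _), pow_mul,
        totalVariation_minus]
      exact pow_le_pow_left₀ (totalVariation_nonneg _) (ih _) 2

/-- Synthetic channels with few plus transforms are worse than all those with many of them. -/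
theorem exists_bhattacharyya_synthetic_lt (hZ : W.bhattacharyya ∈ Set.Ioo (0 : ℝ) 1) (k : ℕ) :
    ∃ K, ∀ n i j, binaryWeight n i ≤ k → K < binaryWeight n j →
      (W.synthetic n j).bhattacharyya < (W.synthetic n i).bhattacharyya := by
  have hT0 : 0 < W.totalVariation := by
    linarith [W.one_sub_bhattacharyya_le_totalVariation, hZ.2]
  have hT1 : W.totalVariation < 1 := W.totalVariation_lt_one hZ.1
  set T := W.totalVariation with hT
  set b := 1 - (1 - T) ^ 2 ^ k with hb
  have hb0 : 0 ≤ b := sub_nonneg.2 (pow_le_one₀ (by linarith) (by linarith))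
  have hb1 : b < 1 := sub_lt_self _ (pow_pos (by linarith) _)
  -- The m extra minus steps push the bound b for channel i below T/2. The comparison to reach is 1
  -- - Z_i ≤ T_i < T_j²/2 ≤ 1 - Z_j; the square and the factor 2 are the loss in passing between Z
  -- and total variation.
  obtain ⟨m, hm⟩ := exists_pow_lt_of_lt_one (half_pos hT0) hb1
  have hs : b ^ 2 ^ m < T / 2 :=
    (pow_le_pow_of_le_one hb0 hb1.le Nat.lt_two_pow_self.le).trans_lt hm
  refine ⟨k + m, fun n i j hi hj => ?_⟩
  have hjn := binaryWeight_le n j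
  have hin := binaryWeight_le n i
  -- Channel j has at most r minus steps and channel i at least m + 1 + r; the additional one
  -- absorbs the square of T_j.
  obtain ⟨r, rfl⟩ : ∃ r, n = k + m + 1 + r := ⟨n - (k + m + 1), by omega⟩
  set n := k + m + 1 + r
  have h1 := (W.synthetic n i).one_sub_bhattacharyya_le_totalVariation
  have h2 := (W.synthetic n j).totalVariation_sq_le
  have h3 : (W.synthetic n i).totalVariation ≤ (b ^ 2 ^ m) ^ 2 ^ (r + 1) := by
    refine (W.totalVariation_synthetic_le n i).trans ?_
    rw [← pow_mul, ← pow_add]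
    have hle : 1 - (1 - T) ^ 2 ^ binaryWeight n i ≤ b :=
      sub_le_sub_left (pow_le_pow_of_le_one (by linarith) (by linarith)
        (Nat.pow_le_pow_right two_pos hi)) 1
    refine (pow_le_pow_left₀ (sub_nonneg.2 (pow_le_one₀ (by linarith) (by linarith))) hle _).trans
      (pow_le_pow_of_le_one hb0 hb1.le (Nat.pow_le_pow_right two_pos ?_))
    omega
  have h4 : T ^ 2 ^ (r + 1) ≤ (W.synthetic n j).totalVariation ^ 2 := by
    rw [pow_succ 2, pow_mul]
    refine pow_le_pow_left₀ (by positivity) (le_trans ?_ (W.pow_totalVariation_le_synthetic n j)) 2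
    exact pow_le_pow_of_le_one hT0.le hT1.le (Nat.pow_le_pow_right two_pos (by omega))
  have h5 : (b ^ 2 ^ m) ^ 2 ^ (r + 1) < (T / 2) ^ 2 ^ (r + 1) :=
    pow_lt_pow_left₀ hs (by positivity) (by positivity)
  have h6 : (T / 2) ^ 2 ^ (r + 1) ≤ T ^ 2 ^ (r + 1) / 2 := by
    rw [div_pow]
    refine div_le_div_of_nonneg_left (by positivity) two_pos ?_
    exact le_self_pow₀ (by norm_num) (by positivity)
  linarith

end BinaryChannel

/-! ### The polar matrix -/

theorem binaryWeight_eq_sum (n : ℕ) (i : Fin (2 ^ n)) :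
    binaryWeight n i = ∑ t, (finFunctionFinEquiv.symm i t : ℕ) := by
  rw [binaryWeight, Finset.sum_range]
  rfl

theorem polarMatrix_apply (n : ℕ) (i j : Fin (2 ^ n)) :
    polarMatrix n i j = ∏ t : Fin n, (!![1, 0; 1, 1] : Matrix (Fin 2) (Fin 2) (ZMod 2))
      (finFunctionFinEquiv.symm i t) (finFunctionFinEquiv.symm j t) := rfl

/-- The 2 × 2 kernel is its own inverse modulo 2, and Kronecker powers inherit this. -/
theorem polarMatrix_mul_self (n : ℕ) : polarMatrix n * polarMatrix n = 1 := by
  ext i k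
  have h : ∀ a c : Fin 2, ∑ b, (!![1, 0; 1, 1] : Matrix (Fin 2) (Fin 2) (ZMod 2)) a b *
      (!![1, 0; 1, 1] : Matrix (Fin 2) (Fin 2) (ZMod 2)) b c = if a = c then 1 else 0 := by
    decide
  rw [Matrix.mul_apply, ← finFunctionFinEquiv.sum_comp]
  simp only [polarMatrix_apply, Equiv.symm_apply_apply, ← Finset.prod_mul_distrib]
  have e := Fintype.prod_sum fun (t : Fin n) (b : Fin 2) =>
    (!![1, 0; 1, 1] : Matrix (Fin 2) (Fin 2) (ZMod 2)) (finFunctionFinEquiv.symm i t) b *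
      (!![1, 0; 1, 1] : Matrix (Fin 2) (Fin 2) (ZMod 2)) b (finFunctionFinEquiv.symm k t)
  rw [← e]
  simp only [h]
  by_cases hik : i = k
  · subst hik
    rw [Matrix.one_apply_eq]
    exact Finset.prod_eq_one fun t _ => if_pos rfl
  · obtain ⟨t, ht⟩ : ∃ t, finFunctionFinEquiv.symm i t ≠ finFunctionFinEquiv.symm k t := by
      by_contra! hc
      exact hik (finFunctionFinEquiv.symm.injective (funext hc))
    rw [Matrix.one_apply_ne hik]
    exact Finset.prod_eq_zero (Finset.mem_univ t) (if_neg ht)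

theorem linearIndependent_polarMatrix_row (n : ℕ) :
    LinearIndependent (ZMod 2) (polarMatrix n).row :=
  Matrix.linearIndependent_rows_iff_isUnit.2
    (IsUnit.of_mul_eq_one _ (polarMatrix_mul_self n))

theorem finrank_span_polarMatrix_row (n : ℕ) (A : Set (Fin (2 ^ n))) :
    Module.finrank (ZMod 2) (Submodule.span (ZMod 2) ((fun i => (polarMatrix n).row i) '' A)) =
      A.ncard := by
  classical
  have : Fintype A := Fintype.ofFinite A
  rw [Set.image_eq_range, ← Nat.card_coe_set_eq, Nat.card_eq_fintype_card]
  exact finrank_span_eq_card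
    ((linearIndependent_polarMatrix_row n).comp _ Subtype.val_injective)

/-- The weight of a combination of rows of the polar matrix is at least that of a minimal row which
it involves. -/
theorem two_pow_le_card_of_minimal {n : ℕ} (l : (Fin n → Fin 2) → ZMod 2) (a₀ : Fin n → Fin 2)
    (h₀ : l a₀ ≠ 0) (hmin : ∀ a ≤ a₀, l a ≠ 0 → a = a₀) :
    2 ^ (∑ t, (a₀ t : ℕ)) ≤ (Finset.univ.filter fun b : Fin n → Fin 2 =>
      ∑ a, l a * ∏ t, (!![1, 0; 1, 1] : Matrix (Fin 2) (Fin 2) (ZMod 2)) (a t) (b t) ≠ 0).card := by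
  set M := (!![1, 0; 1, 1] : Matrix (Fin 2) (Fin 2) (ZMod 2)) with hM
  have zero_of_lt : ∀ α α₀ ε : Fin 2, ¬ α ≤ α₀ →
      ∑ β, M α β * (if α₀ = 1 → β = ε then 1 else 0) = 0 := by
    rw [hM]; decide
  have one_of_le : ∀ α₀ ε : Fin 2, ε ≤ α₀ →
      ∑ β, M α₀ β * (if α₀ = 1 → β = ε then 1 else 0) = 1 := by
    rw [hM]; decide
  -- Each e ≤ a₀ labels the subcube of positions b that agree with e wherever a₀ is 1. These
  -- subcubes are disjoint, and each must contain a nonzero entry of the combination.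
  have exists_b : ∀ e ≤ a₀, ∃ b : Fin n → Fin 2,
      ∑ a, l a * ∏ t, M (a t) (b t) ≠ 0 ∧ ∀ t, a₀ t = 1 → b t = e t := by
    intro e he
    by_contra! hc
    have hsum : ∑ b : Fin n → Fin 2, (∑ a, l a * ∏ t, M (a t) (b t)) *
        ∏ t, (if a₀ t = 1 → b t = e t then (1 : ZMod 2) else 0) = 0 := by
      refine Finset.sum_eq_zero fun b _ => ?_
      by_cases hb : ∑ a, l a * ∏ t, M (a t) (b t) = 0
      · rw [hb, zero_mul]
      · obtain ⟨t, ht1, ht2⟩ := hc b hb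
        rw [Finset.prod_eq_zero (Finset.mem_univ t), mul_zero]
        rw [if_neg]
        exact fun h => ht2 (h ht1)
    have hswap : ∑ b : Fin n → Fin 2, (∑ a, l a * ∏ t, M (a t) (b t)) *
        ∏ t, (if a₀ t = 1 → b t = e t then (1 : ZMod 2) else 0) =
        ∑ a, l a * ∏ t, ∑ β, M (a t) β * (if a₀ t = 1 → β = e t then 1 else 0) := by
      simp only [Finset.sum_mul, mul_assoc, ← Finset.prod_mul_distrib]
      rw [Finset.sum_comm]
      refine Finset.sum_congr rfl fun a _ => ?_
      rw [← Finset.mul_sum, Fintype.prod_sum]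
    -- The sum of the combination over the subcube is l a₀: a row not below a₀ has a free coordinate
    -- contributing 1 + 1 = 0, and rows strictly below a₀ have zero coefficient by minimality.
    rw [hswap, Finset.sum_eq_single a₀ _ (by simp)] at hsum
    · rw [Finset.prod_congr rfl fun t _ => one_of_le _ _ (he t)] at hsum
      exact h₀ (by simpa using hsum)
    · intro a _ ha
      by_cases hle : a ≤ a₀
      · rw [not_not.1 fun h => ha (hmin a hle h), zero_mul]
      · obtain ⟨t, ht⟩ : ∃ t, ¬ a t ≤ a₀ t := by
          by_contra! hc'
          exact hle hc'
        rw [Finset.prod_eq_zero (Finset.mem_univ t) (zero_of_lt _ _ _ ht), mul_zero]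
  have hcard : (Fintype.piFinset fun t => Finset.Iic (a₀ t)).card = 2 ^ (∑ t, (a₀ t : ℕ)) := by
    rw [Fintype.card_piFinset, ← Finset.prod_pow_eq_pow_sum]
    refine Finset.prod_congr rfl fun t _ => ?_
    generalize a₀ t = α
    revert α
    decide
  rw [← hcard]
  choose! b hb1 hb2 using exists_b
  have hmem : ∀ e, e ∈ (Fintype.piFinset fun t => Finset.Iic (a₀ t)) ↔ e ≤ a₀ := by
    intro e
    simp [Fintype.mem_piFinset, Pi.le_def]
  refine Finset.card_le_card_of_injOn b (fun e he => ?_) fun e he e' he' hee => ?_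
  · simpa using hb1 e ((hmem e).1 he)
  · have he := (hmem e).1 he
    have he' := (hmem e').1 he'
    funext t
    have aux : ∀ α ε ε' : Fin 2, ε ≤ α → ε' ≤ α → (α = 1 → ε = ε') → ε = ε' := by decide
    refine aux (a₀ t) _ _ (he t) (he' t) fun h1 => ?_
    rw [← hb2 e he t h1, ← hb2 e' he' t h1, hee]

theorem exists_two_pow_binaryWeight_le_hammingNorm {n : ℕ} {A : Set (Fin (2 ^ n))}
    {c : Fin (2 ^ n) → ZMod 2}
    (hc : c ∈ Submodule.span (ZMod 2) ((fun i => (polarMatrix n).row i) '' A)) (hc0 : c ≠ 0) :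
    ∃ i ∈ A, 2 ^ binaryWeight n i ≤ hammingNorm c := by
  classical
  obtain ⟨l, hl, rfl⟩ := (Finsupp.mem_span_image_iff_linearCombination _).1 hc
  set l' : (Fin n → Fin 2) → ZMod 2 := fun a => l (finFunctionFinEquiv a) with hl'
  obtain ⟨a, ha⟩ : ∃ a, l' a ≠ 0 := by
    by_contra! h
    refine hc0 ?_
    have : l = 0 := by
      ext i
      simpa [hl'] using h (finFunctionFinEquiv.symm i)
    rw [this, map_zero]
  obtain ⟨a₀, h₀, hmin⟩ := exists_minimal_of_wellFoundedLT (fun a => l' a ≠ 0) ⟨a, ha⟩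
  refine ⟨finFunctionFinEquiv a₀, ?_, ?_⟩
  · exact (Finsupp.mem_supported _ _).1 hl (Finsupp.mem_support_iff.2 h₀)
  · rw [binaryWeight_eq_sum, Equiv.symm_apply_apply]
    refine (two_pow_le_card_of_minimal l' a₀ h₀ fun a hle ha => le_antisymm hle (hmin ha hle)).trans ?_
    rw [hammingNorm]
    refine Finset.card_le_card_of_injOn finFunctionFinEquiv (fun b hb => ?_)
      finFunctionFinEquiv.injective.injOn
    simp only [Finset.coe_filter, Finset.mem_univ, true_and, Set.mem_ofPred_eq] at hb ⊢
    rw [Finsupp.linearCombination_apply, Finsupp.sum_fintype _ _ (by simp), Finset.sum_apply,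
      ← finFunctionFinEquiv.sum_comp]
    simpa only [Equiv.symm_apply_apply, polarMatrix_apply, Matrix.row, hl', Pi.smul_apply,
      smul_eq_mul] using hb

/-- An exponential Markov bound: weighting each index by (1/3)^w gives total (1 + 1/3)^n. All that
matters later is 4/3 < 2. -/
theorem card_binaryWeight_le (n K : ℕ) :
    ((Finset.univ.filter fun i : Fin (2 ^ n) => binaryWeight n i ≤ K).card : ℝ) ≤
      3 ^ K * (4 / 3) ^ n := by
  have h1 : ∑ i : Fin (2 ^ n), (1 / 3 : ℝ) ^ binaryWeight n i = (4 / 3) ^ n := by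
    simp only [binaryWeight_eq_sum]
    rw [← finFunctionFinEquiv.sum_comp]
    simp only [Equiv.symm_apply_apply, ← Finset.prod_pow_eq_pow_sum]
    have e := Fintype.prod_sum fun (_ : Fin n) (b : Fin 2) => (1 / 3 : ℝ) ^ (b : ℕ)
    rw [← e]
    rw [Finset.prod_const, Finset.card_univ, Fintype.card_fin, Fin.sum_univ_two]
    norm_num
  have h2 : ((Finset.univ.filter fun i : Fin (2 ^ n) => binaryWeight n i ≤ K).card : ℝ) *
      (1 / 3) ^ K ≤ (4 / 3) ^ n := by
    rw [← h1, ← nsmul_eq_mul]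
    refine le_trans (Finset.card_nsmul_le_sum _ (fun i : Fin (2 ^ n) =>
      (1 / 3 : ℝ) ^ binaryWeight n i) _ fun i hi => ?_)
      (Finset.sum_le_sum_of_subset_of_nonneg (Finset.filter_subset _ _)
        fun i _ _ => by positivity)
    exact pow_le_pow_of_le_one (by norm_num) (by norm_num) (Finset.mem_filter.1 hi).2
  rw [one_div, inv_pow, ← div_eq_mul_inv, div_le_iff₀ (by positivity)] at h2
  linarith

/-- The minimum distance of polar codes of rate bounded away from one tends to infinity. -/
theorem BinaryChannel.exists_le_hammingNorm_of_mem_polarCode (W : BinaryChannel.{u})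
    (hZ : W.bhattacharyya ∈ Set.Ioo (0 : ℝ) 1) {R₀ : ℝ} (hR₀ : R₀ < 1) (d : ℕ) :
    ∃ n₀, ∀ n ≥ n₀, ∀ A : Set (Fin (2 ^ n)),
      (∀ i ∈ A, ∀ j ∉ A, (W.synthetic n i).bhattacharyya ≤ (W.synthetic n j).bhattacharyya) →
      (A.ncard : ℝ) ≤ 2 ^ n * R₀ + 1 →
      ∀ c ∈ Submodule.span (ZMod 2) ((fun i => (polarMatrix n).row i) '' A), c ≠ 0 →
        d ≤ hammingNorm c := by
  classical
  obtain ⟨K, hK⟩ := W.exists_bhattacharyya_synthetic_lt hZ d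
  -- These are the fraction of indices with at most K ones and the rounding error 1 of the
  -- dimension, both relative to 2^n.
  have hlim : Tendsto (fun n : ℕ => (3 : ℝ) ^ K * (2 / 3) ^ n + (1 / 2) ^ n) atTop (𝓝 0) := by
    have h1 := (tendsto_pow_atTop_nhds_zero_of_lt_one (r := (2 / 3 : ℝ))
      (by norm_num) (by norm_num)).const_mul ((3 : ℝ) ^ K)
    have h2 := tendsto_pow_atTop_nhds_zero_of_lt_one (r := (1 / 2 : ℝ))
      (by norm_num) (by norm_num)
    simpa using h1.add h2
  obtain ⟨n₀, hn₀⟩ := eventually_atTop.1 (hlim.eventually_lt_const (sub_pos.2 hR₀))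
  refine ⟨n₀, fun n hn A hA hcard c hc hc0 => ?_⟩
  obtain ⟨i, hiA, hi⟩ := exists_two_pow_binaryWeight_le_hammingNorm hc hc0
  by_contra! hlt
  have hid : binaryWeight n i ≤ d := (Nat.lt_two_pow_self.le.trans hi).trans hlt.le
  -- Selecting the poor index i forces the selection of every index with more than K ones.
  have hsub : (Finset.univ.filter fun j : Fin (2 ^ n) => ¬ binaryWeight n j ≤ K) ⊆ A.toFinset := by
    intro j hj
    rw [Set.mem_toFinset]
    by_contra hjA
    exact (hA i hiA j hjA).not_gt (hK n i j hid (not_le.1 (Finset.mem_filter.1 hj).2))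
  have h1 := Finset.card_le_card hsub
  rw [← Set.ncard_eq_toFinset_card'] at h1
  have h2 := Finset.card_filter_add_card_filter_not (s := (Finset.univ : Finset (Fin (2 ^ n))))
    (fun j => binaryWeight n j ≤ K)
  rw [Finset.card_univ, Fintype.card_fin] at h2
  have h3 := card_binaryWeight_le n K
  have h4 : (2 : ℝ) ^ n ≤ 3 ^ K * (4 / 3) ^ n + (2 ^ n * R₀ + 1) := by
    have : ((2 ^ n : ℕ) : ℝ) ≤ 3 ^ K * (4 / 3) ^ n + A.ncard := by
      refine (congrArg (Nat.cast : ℕ → ℝ) h2.symm).trans_le ?_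
      push_cast
      exact add_le_add h3 (by exact_mod_cast h1)
    push_cast at this
    linarith
  have h5 := mul_lt_mul_of_pos_left (hn₀ n hn) (by positivity : (0 : ℝ) < 2 ^ n)
  have e1 : (2 : ℝ) ^ n * (3 ^ K * (2 / 3) ^ n + (1 / 2) ^ n) = 3 ^ K * (4 / 3) ^ n + 1 := by
    rw [mul_add, ← mul_pow, mul_left_comm, ← mul_pow]
    norm_num
  rw [e1] at h5
  linarith

/-! ### The scaling filter -/

section ScalingFilter

variable {lengths : Set ℕ} {C μ z : ℝ}

theorem tendsto_fst_scalingFilter : Tendsto Prod.fst (scalingFilter lengths C μ z) atTop :=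
  tendsto_comap.mono_left inf_le_left

theorem eventually_mem_scalingFilter : ∀ᶠ x in scalingFilter lengths C μ z,
    x.1 ∈ lengths ∧ (x.1 : ℝ) ^ (1 / μ) * (C - x.2) = z :=
  mem_inf_of_right (mem_principal_self _)

/-- For every positive admissible length the equation can be solved for the rate, which the filter
does not confine to [0, 1]. -/
theorem scalingFilter_neBot (h : lengths.Infinite) : (scalingFilter lengths C μ z).NeBot := by
  rw [scalingFilter, inf_principal_neBot_iff]
  intro U hU
  obtain ⟨V, hV, hVU⟩ := mem_comap.1 hU
  obtain ⟨a, ha⟩ := mem_atTop_sets.1 hV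
  obtain ⟨N, hN, hlt⟩ := h.exists_gt a
  have hpos : (0 : ℝ) < (N : ℝ) ^ (1 / μ) :=
    Real.rpow_pos_of_pos (by exact_mod_cast (Nat.zero_le a).trans_lt hlt) _
  refine ⟨(N, C - z / (N : ℝ) ^ (1 / μ)), hVU (ha N hlt.le), hN, ?_⟩
  dsimp only
  rw [sub_sub_cancel, mul_div_cancel₀ _ hpos.ne']

theorem tendsto_snd_scalingFilter (hμ : 0 < μ) :
    Tendsto Prod.snd (scalingFilter lengths C μ z) (𝓝 C) := by
  have h1 : Tendsto (fun x : ℕ × ℝ => (x.1 : ℝ) ^ (1 / μ)) (scalingFilter lengths C μ z) atTop :=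
    (tendsto_rpow_atTop (one_div_pos.2 hμ)).comp
      (tendsto_natCast_atTop_atTop.comp tendsto_fst_scalingFilter)
  have h2 := (tendsto_const_nhds (x := C)).sub (h1.const_div_atTop z)
  rw [sub_zero] at h2
  refine h2.congr' ?_
  filter_upwards [h1.eventually_gt_atTop 0, eventually_mem_scalingFilter] with x hx hx'
  rw [← hx'.2, mul_div_cancel_left₀ _ hx.ne', sub_sub_cancel]

end ScalingFilter

/-! ### Divergence of the minimum distance and conclusion -/

theorem eventually_le_hammingNorm_of_isPolarFamily {W : BinaryChannel.{u}} {F : LinearCodeFamily}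
    {C μ z : ℝ} (hF : IsPolarFamily W F) (hZ : W.bhattacharyya ∈ Set.Ioo (0 : ℝ) 1)
    (hC : C ∈ Set.Ioo (0 : ℝ) 1) (hμ : 0 < μ) (d : ℕ) :
    ∀ᶠ x : ℕ × ℝ in scalingFilter F.lengths C μ z, ∀ c ∈ F.code x.1 x.2, c ≠ 0 → d ≤ hammingNorm c := by
  obtain ⟨R₀, hR₀, hR₀1⟩ := exists_between hC.2
  obtain ⟨n₀, hn₀⟩ := W.exists_le_hammingNorm_of_mem_polarCode hZ hR₀1 d
  filter_upwards [eventually_mem_scalingFilter,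
    tendsto_fst_scalingFilter.eventually_ge_atTop (2 ^ n₀),
    -- The rate tends to the capacity, so it eventually lies in (0, R₀), where the constraints on
    -- the code are in force.
    (tendsto_snd_scalingFilter hμ).eventually (Ioo_mem_nhds hC.1 hR₀)]
  rintro ⟨N, R⟩ ⟨hN, -⟩ hle ⟨hR1, hR2⟩
  dsimp only at *
  have hN' := hN
  rw [hF.1] at hN'
  obtain ⟨n, rfl⟩ := hN'
  have hR : R ∈ Set.Icc (0 : ℝ) 1 := ⟨hR1.le, (hR2.trans hR₀1).le⟩
  obtain ⟨A, hA, hcode⟩ := hF.2 n R hR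
  have hdim := F.dim_code _ hN R hR
  dsimp only at hdim
  rw [hcode, finrank_span_polarMatrix_row] at hdim
  rw [hcode]
  refine hn₀ n ((Nat.pow_le_pow_iff_right (by norm_num)).1 hle) A hA ?_
  have h1 := (abs_lt.1 hdim).2
  push_cast at h1
  have h2 := mul_le_mul_of_nonneg_left hR2.le (by positivity : (0 : ℝ) ≤ 2 ^ n)
  linarith

theorem minDistance_le_hammingNorm {N : ℕ} {D : Submodule (ZMod 2) (Fin N → ZMod 2)}
    {c : Fin N → ZMod 2} (hc : c ∈ D) (hc0 : c ≠ 0) : minDistance D ≤ hammingNorm c :=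
  Nat.sInf_le ⟨c, hc, hc0, rfl⟩

/-- A sequence of functions, each of which is eventually bounded below by a quarter of the square of
the preceding one up to arbitrarily small errors, is bounded below by iterated squares. -/
theorem eventually_iterated_sq_sub_le {X : Type*} {l : Filter X} {P : ℕ → X → ℝ} {a : ℝ}
    (ha : a ∈ Set.Icc (0 : ℝ) 1)
    (h0 : ∀ ε > 0, ∀ᶠ x in l, a - ε ≤ P 0 x)
    (hstep : ∀ k, ∀ ε > 0, ∀ᶠ x in l, P k x ^ 2 / 4 - ε ≤ P (k + 1) x) (k : ℕ) :
    ∀ ε > 0, ∀ᶠ x in l, (1 / 4 : ℝ) ^ (2 ^ k - 1) * a ^ 2 ^ k - ε ≤ P k x := by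
  induction k with
  | zero => simpa using h0
  | succ k ih =>
    intro ε hε
    set c := (1 / 4 : ℝ) ^ (2 ^ k - 1) * a ^ 2 ^ k with hc
    have hc0 : 0 ≤ c := mul_nonneg (by positivity) (pow_nonneg ha.1 _)
    have hc1 : c ≤ 1 := mul_le_one₀ (pow_le_one₀ (by norm_num) (by norm_num))
      (pow_nonneg ha.1 _) (pow_le_one₀ ha.1 ha.2)
    have e : (1 / 4 : ℝ) ^ (2 ^ (k + 1) - 1) * a ^ 2 ^ (k + 1) = c ^ 2 / 4 := by
      have : 2 ^ (k + 1) - 1 = (2 ^ k - 1) * 2 + 1 := by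
        have := Nat.one_le_two_pow (n := k)
        omega
      rw [this, pow_succ 2 k, pow_mul a, pow_succ (1 / 4 : ℝ), pow_mul (1 / 4 : ℝ), hc]
      ring
    rw [e]
    filter_upwards [ih ε hε, hstep k (ε / 2) (half_pos hε)] with x hx1 hx2
    -- From P² ≥ c² - 2c(c - P) and c ≤ 1; no sign of P is needed.
    have h3 : c ^ 2 - 2 * ε ≤ P k x ^ 2 := by
      have : c * (c - P k x) ≤ ε := by
        rcases le_total (c - P k x) 0 with h | h
        · exact (mul_nonpos_of_nonneg_of_nonpos hc0 h).trans hε.le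
        · exact (mul_le_of_le_one_left h hc1).trans (by linarith)
      nlinarith [sq_nonneg (c - P k x)]
    linarith

theorem theorem3 (W : BinaryChannel.{u}) (hW : W.IsSymmetric)
    (hC : W.capacity ∈ Set.Ioo (0 : ℝ) 1) (hZ : W.bhattacharyya ∈ Set.Ioo (0 : ℝ) 1)
    (F : LinearCodeFamily) (μ : ℝ) (f : ℝ → ℝ)
    (hlaw : ScalingLaw F.lengths W.capacity
      (fun N R => W.mapListError (F.code N R) 1) μ f)
    (z : ℝ)
    (hF : IsPolarFamily W F ∨
      Tendsto (fun x : ℕ × ℝ => minDistance (F.code x.1 x.2))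
        (scalingFilter F.lengths W.capacity μ z) atTop)
    (L : ℕ) (hL : 1 ≤ L) :
    limsup (fun x : ℕ × ℝ => W.mapListError (F.code x.1 x.2) L)
        (scalingFilter F.lengths W.capacity μ z) ≤ f z ∧
    (3 / 16 : ℝ) ^ (2 ^ (L - 1) - 1) * f z ^ (2 ^ (L - 1)) ≤
      liminf (fun x : ℕ × ℝ => W.mapListError (F.code x.1 x.2) L)
        (scalingFilter F.lengths W.capacity μ z) := by
  obtain ⟨hμ, hf, hlim⟩ := hlaw
  have hne : (scalingFilter F.lengths W.capacity μ z).NeBot :=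
    scalingFilter_neBot F.infinite_lengths
  have hle : ∀ l, IsBoundedUnder (· ≤ ·) (scalingFilter F.lengths W.capacity μ z)
      fun x : ℕ × ℝ => W.mapListError (F.code x.1 x.2) l := fun l =>
    isBoundedUnder_of ⟨1, fun x => (W.mapListError_mem_Icc _ l).2⟩
  have hge : ∀ l, IsBoundedUnder (· ≥ ·) (scalingFilter F.lengths W.capacity μ z)
      fun x : ℕ × ℝ => W.mapListError (F.code x.1 x.2) l := fun l =>
    isBoundedUnder_of ⟨0, fun x => (W.mapListError_mem_Icc _ l).1⟩
  have hdist : ∀ d : ℕ, ∀ᶠ x : ℕ × ℝ in scalingFilter F.lengths W.capacity μ z,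
      ∀ c ∈ F.code x.1 x.2, c ≠ 0 → d ≤ hammingNorm c := by
    intro d
    rcases hF with hF | hF
    · exact eventually_le_hammingNorm_of_isPolarFamily hF hZ hC hμ d
    · filter_upwards [hF.eventually_ge_atTop d] with x hx c hc hc0
      exact hx.trans (minDistance_le_hammingNorm hc hc0)
  have hstep : ∀ k, ∀ ε > 0, ∀ᶠ x : ℕ × ℝ in scalingFilter F.lengths W.capacity μ z,
      W.mapListError (F.code x.1 x.2) (k + 1) ^ 2 / 4 - ε ≤
        W.mapListError (F.code x.1 x.2) (k + 1 + 1) := by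
    intro k ε hε
    obtain ⟨d, hd⟩ := exists_pow_lt_of_lt_one hε hZ.2
    filter_upwards [hdist d] with x hx
    have := W.sq_mapListError_div_four_sub_le hZ.2.le hx k.succ_pos
    linarith
  have hbase : ∀ ε > 0, ∀ᶠ x : ℕ × ℝ in scalingFilter F.lengths W.capacity μ z,
      f z - ε ≤ W.mapListError (F.code x.1 x.2) (0 + 1) := fun ε hε =>
    ((hlim z).eventually_const_lt (sub_lt_self _ hε)).mono fun x hx => hx.le
  refine ⟨?_, ?_⟩
  · rw [← (hlim z).limsup_eq]
    exact limsup_le_limsup (Eventually.of_forall fun x => W.mapListError_anti _ hL)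
      (hge L).isCoboundedUnder_le (hle 1)
  · have key := eventually_iterated_sq_sub_le (hf z)
      (P := fun k (x : ℕ × ℝ) => W.mapListError (F.code x.1 x.2) (k + 1)) hbase hstep (L - 1)
    simp only [Nat.sub_add_cancel hL] at key
    refine le_of_forall_pos_sub_le fun ε hε => ?_
    have hlow : (1 / 4 : ℝ) ^ (2 ^ (L - 1) - 1) * f z ^ 2 ^ (L - 1) - ε ≤
        liminf (fun x : ℕ × ℝ => W.mapListError (F.code x.1 x.2) L)
          (scalingFilter F.lengths W.capacity μ z) :=
      le_liminf_of_le (hle L).isCoboundedUnder_ge (key ε hε)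
    refine le_trans ?_ hlow
    refine sub_le_sub_right (mul_le_mul_of_nonneg_right ?_ (pow_nonneg (hf z).1 _)) ε
    -- The splitting argument gives 1/4, which is larger than 3/16.
    exact pow_le_pow_left₀ (by norm_num) (by norm_num) _
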